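/- Fix integers $k_1,k_2\ge 1$. For integers $n,q\ge 1$, a mixture of $k$ product distributions over $[q]^n$ is given by mixing weights $\alpha^{(1)},\dots,\alpha^{(k)}\ge 0$ with $\sum_s\alpha^{(s)}=1$ and by marginal distributions $\mathcal P^{(s)}_i$ on $[q]$ ($s\in[k]$, $i\in[n]$); it is the distribution $\mathcal P(\omega)=\sum_{s=1}^{k}\alpha^{(s)}\prod_{i=1}^n\mathcal P^{(s)}_i(\omega_i)$, $\omega\in[q]^n$. The total variation distance of two such distributions is $d_{\mathrm{TV}}(\mathcal P,\mathcal Q)=\frac12\sum_{\omega\in[q]^n}|\mathcal P(\omega)-\mathcal Q(\omega)|$. There are a randomized algorithm and a constant $C$, both depending only on $k_1$ and $k_2$, such that for all $n,q\ge 1$, every $\varepsilon>0$, every mixture $\mathcal P$ of $k_1$ product distributions over $[q]^n$ and every mixture $\mathcal Q$ of $k_2$ product distributions over $[q]^n$, the following holds. Given $n$, $q$, $\varepsilon$ and the mixing weights and marginals of $\mathcal P$ and $\mathcal Q$, the algorithm always halts after at most $$C\cdot\max\Bigl\{1,\ \frac{q^2\,(nq)^{2(k_1+k_2-1)}}{\varepsilon^2}\Bigr\}$$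 steps, and it outputs a random number $\hat d$ with $$\Pr\bigl[(1-\varepsilon)\,d_{\mathrm{TV}}(\mathcal P,\mathcal Q)\le\hat d\le(1+\varepsilon)\,d_{\mathrm{TV}}(\mathcal P,\mathcal Q)\bigr]\ \ge\ \frac{99}{100}.$$ Here an algorithm is a single program for a real RAM: in unit time the machine can perform an arithmetic operation on reals ($+,-,\times,/$) or on natural numbers ($+,\times$, truncated subtraction), convert a natural number to a real, compare two reals or two natural numbers, read or write a memory cell addressed by a natural number, and toss a coin that shows heads with a probability $p\in[0,1]$ held in memory; there is no rounding of reals to integers. -/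

import Mathlib

open scoped ENNReal

/-! ## Mixtures of product distributions -/

/-- The data specifying a mixture of `k` product distributions over `[q]^n`: the mixing weights
and, for each component `s` and each coordinate `i`, a marginal distribution on `[q]`. -/
structure Mixture (k n q : ℕ) where
  weight : Fin k → ℝ
  marginal : Fin k → Fin n → Fin q → ℝ
  weight_mem : weight ∈ stdSimplex ℝ (Fin k)
  marginal_mem : ∀ s i, marginal s i ∈ stdSimplex ℝ (Fin q)

namespace Mixture

variable {k k₁ k₂ n q : ℕ}

/-- The probability mass that the mixture gives to the point `ω` of `[q]^n`. -/
noncomputable def prob (P : Mixture k n q) (ω : Fin n → Fin q) : ℝ :=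
  ∑ s, P.weight s * ∏ i, P.marginal s i (ω i)

/-- The total variation distance between two mixtures over `[q]^n`. -/
noncomputable def tvDist (P : Mixture k₁ n q) (Q : Mixture k₂ n q) : ℝ :=
  (1 / 2) * ∑ ω : Fin n → Fin q, |P.prob ω - Q.prob ω|

end Mixture

/-! ## A randomized real RAM

The memory consists of arrays of natural numbers and arrays of real numbers, which are addressed by
the values of arithmetic expressions.  A program is a finite piece of syntax, so it mentions only
finitely many arrays, and each step evaluates expressions whose size is fixed by the program.
There is no rounding from reals to integers, and no integer division. -/

namespace RealRAM

structure Memory where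
  nat : ℕ → ℕ → ℕ
  real : ℕ → ℕ → ℝ

/-- Natural number expressions.  `read a i` is entry `i` of the natural number array `a`. -/
inductive NExp where
  | const (c : ℕ)
  | read (a : ℕ) (i : NExp)
  | add (x y : NExp)
  | sub (x y : NExp)
  | mul (x y : NExp)

/-- Real expressions.  `read a i` is entry `i` of the real array `a`. -/
inductive RExp where
  | cast (x : NExp)
  | read (a : ℕ) (i : NExp)
  | add (x y : RExp)
  | sub (x y : RExp)
  | mul (x y : RExp)
  | div (x y : RExp)

/-- Tests. -/
inductive BExp where
  | natLe (x y : NExp)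
  | realLe (x y : RExp)
  | not (b : BExp)
  | and (b c : BExp)

/-- Programs.  `flip a i p` tosses a coin that shows heads with probability `p`, and stores
`1` for heads and `0` for tails in entry `i` of the natural number array `a`. -/
inductive Stmt where
  | skip
  | setNat (a : ℕ) (i : NExp) (x : NExp)
  | setReal (a : ℕ) (i : NExp) (x : RExp)
  | flip (a : ℕ) (i : NExp) (p : RExp)
  | seq (s t : Stmt)
  | ite (b : BExp) (s t : Stmt)
  | loop (b : BExp) (s : Stmt)

def NExp.eval (m : Memory) : NExp → ℕ
  | .const c => c
  | .read a i => m.nat a (i.eval m)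
  | .add x y => x.eval m + y.eval m
  | .sub x y => x.eval m - y.eval m
  | .mul x y => x.eval m * y.eval m

/-- Division by zero gives zero. -/
noncomputable def RExp.eval (m : Memory) : RExp → ℝ
  | .cast x => (x.eval m : ℝ)
  | .read a i => m.real a (i.eval m)
  | .add x y => x.eval m + y.eval m
  | .sub x y => x.eval m - y.eval m
  | .mul x y => x.eval m * y.eval m
  | .div x y => x.eval m / y.eval m

def BExp.Holds (m : Memory) : BExp → Prop
  | .natLe x y => x.eval m ≤ y.eval m
  | .realLe x y => x.eval m ≤ y.eval m
  | .not b => ¬ b.Holds m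
  | .and b c => b.Holds m ∧ c.Holds m

def Memory.setNat (m : Memory) (a i v : ℕ) : Memory :=
  { m with nat := Function.update m.nat a (Function.update (m.nat a) i v) }

def Memory.setReal (m : Memory) (a i : ℕ) (v : ℝ) : Memory :=
  { m with real := Function.update m.real a (Function.update (m.real a) i v) }

/-- The toss of a coin that shows heads (`true`) with probability `p`, where `p` is clamped to
`[0, 1]`: the outcome of the test `U < p` for `U` uniform on `[0, 1]`. -/
noncomputable def coin (p : ℝ) : PMF Bool :=
  PMF.ofFintype
    (fun b => if b then ENNReal.ofReal (min p 1) else 1 - ENNReal.ofReal (min p 1)) <| by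
      simp only [Fintype.sum_bool, if_true, Bool.false_eq_true, if_false]
      exact add_tsub_cancel_of_le (by simp)

/-- A configuration: the statements that remain to be executed, and the memory.
The machine has halted when no statement remains. -/
abbrev Config := List Stmt × Memory

open Classical in
/-- One unit-cost step of the machine.  A halted machine stays as it is. -/
noncomputable def step : Config → PMF Config
  | ([], m) => PMF.pure ([], m)
  | (.skip :: K, m) => PMF.pure (K, m)
  | (.setNat a i x :: K, m) => PMF.pure (K, m.setNat a (i.eval m) (x.eval m))
  | (.setReal a i x :: K, m) => PMF.pure (K, m.setReal a (i.eval m) (x.eval m))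
  | (.flip a i p :: K, m) =>
      (coin (p.eval m)).map fun h => (K, m.setNat a (i.eval m) (if h then 1 else 0))
  | (.seq s t :: K, m) => PMF.pure (s :: t :: K, m)
  | (.ite b s t :: K, m) => PMF.pure (if b.Holds m then s :: K else t :: K, m)
  | (.loop b s :: K, m) => PMF.pure (if b.Holds m then s :: .loop b s :: K else K, m)

/-- The distribution of the configuration after `T` steps. -/
noncomputable def steps : ℕ → Config → PMF Config
  | 0, c => PMF.pure c
  | T + 1, c => (step c).bind (steps T)

/-- Whatever the coins show, the program halts after at most `T` steps on the memory `m`. -/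
def HaltsWithin (prog : Stmt) (m : Memory) (T : ℕ) : Prop :=
  ∀ c ∈ (steps T ([prog], m)).support, c.1 = []

/-- The distribution, after `T` steps on the initial memory `m`, of the output cell, which is
entry `0` of the real array `5`. -/
noncomputable def outputDist (prog : Stmt) (m : Memory) (T : ℕ) : PMF ℝ :=
  (steps T ([prog], m)).map fun c => c.2.real 5 0

/-- The marginals as one array in row-major order, padded by zeros:
`marginal s i c` is entry `(s * n + i) * q + c`. -/
noncomputable def flatMarginals {k n q : ℕ} (P : Mixture k n q) (j : ℕ) : ℝ :=
  if h : j < k * n * q then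
    let x := finProdFinEquiv.symm (⟨j, h⟩ : Fin (k * n * q))
    let y := finProdFinEquiv.symm x.1
    P.marginal y.1 y.2 x.2
  else 0

/-- The mixing weights as an array, padded by zeros. -/
noncomputable def flatWeights {k n q : ℕ} (P : Mixture k n q) (j : ℕ) : ℝ :=
  if h : j < k then P.weight ⟨j, h⟩ else 0

/-- The initial memory.  Entry `0` of the natural number arrays `0` and `1` holds `n` and `q`,
entry `0` of the real array `0` holds `ε`, and the real arrays `1`, `2`, `3`, `4` hold the weights
of `P` and of `Q` and the marginals of `P` and of `Q`.  Everything else is zero. -/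
noncomputable def input {k₁ k₂ n q : ℕ} (ε : ℝ) (P : Mixture k₁ n q) (Q : Mixture k₂ n q) :
    Memory where
  nat
    | 0, 0 => n
    | 1, 0 => q
    | _, _ => 0
  real
    | 0, 0 => ε
    | 1, j => flatWeights P j
    | 2, j => flatWeights Q j
    | 3, j => flatMarginals P j
    | 4, j => flatMarginals Q j
    | _, _ => 0

end RealRAM

/-! The distance is estimated by importance sampling. Put `k = k₁ + k₂` and regard `P - Q` as a
signed mixture `f` of `k` products, so that the distance is `d = ‖f‖₁ / 2`. If `V` is a density from
which words can be drawn, then `|f| / (2 V)` has mean `d` under `V`. If moreover `|f| ≤ ‖f‖₁ M V`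
pointwise, the estimate is at most `M d`, its second moment at most `M d²`, and by Chebyshev the
average of more than `100 M / ε²` independent estimates has relative error at most `ε` with
probability `99/100`.

The point is to find `V` with `M` polynomial in `nq`. Sampling from `P` or `Q` fails, since `P - Q`
may be tiny compared with both almost everywhere. Here `V` is `mass`, the law of the output of a
hidden process that follows one component and, at each coordinate, restarts with probability
`1/(n+1)`: it then puts out a uniform symbol and picks a uniform component.

Domination is `abs_signedMass_le`. For a component `a`, write `f(c :: x) = p_a(c) f(x) + g(x)`,
where `g` has coefficients `(p_s(c) - p_a(c)) u_s`. The first term corresponds to staying in state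
`a`, the second to a restart. The coefficient of `a` in `g` vanishes, so at most `k - 1` restarts
are needed, and `‖g‖₁ ≤ 2 ‖f‖₁` by `signedNorm_splitCoeff_le`. A restart costs a factor `2qk(n+1)`,
and not restarting costs at most `(1 + 1/n)^n ≤ 3` in all, whence `M = 3k(4knq)^(k-1)`, which is
`overhead`.

On the machine, the next symbol is drawn by reservoir sampling with weights `V(c :: x)`, so a sample
takes `O(nq)` steps. The total `O((nq)^k / ε²)` is within the bound because `k ≥ 2`. Correctness is
proved with expectation bounds for programs of exactly known running time: `ExpectLE.loop` carries a
conditional expectation, or an upper bound for it, through each loop. For `ε ≥ 1` the output `0` is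
already good enough. -/

/-! ## Sums over words -/

/-- The sum of `g` over all words that arise from `x` by putting `r` further symbols in front. -/
def wordSum {α β : Type*} [Fintype α] [AddCommMonoid β] (g : List α → β) : ℕ → List α → β
  | 0, x => g x
  | r + 1, x => ∑ c, wordSum g r (c :: x)

section WordSum

variable {α β : Type*} [Fintype α] [AddCommMonoid β]

/-- The definition sums over the symbol next to `x` outermost; here the symbol added last is
innermost, which is what marginalising out the last coordinate requires. -/
theorem wordSum_succ' (g : List α → β) (r : ℕ) (x : List α) :
    wordSum g (r + 1) x = wordSum (fun y => ∑ c, g (c :: y)) r x := by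
  induction r generalizing x with
  | zero => rfl
  | succ r ih =>
    rw [wordSum]
    simp only [ih]
    rw [wordSum]

theorem wordSum_nil_eq_sum (g : List α → β) (n : ℕ) :
    wordSum g n [] = ∑ ω : Fin n → α, g (List.ofFn ω).reverse := by
  induction n generalizing g with
  | zero => simp [wordSum]
  | succ n ih =>
    rw [wordSum_succ', ih, ← (Fin.snocEquiv fun _ : Fin (n + 1) => α).sum_comp,
      Fintype.sum_prod_type, Finset.sum_comm]
    refine Finset.sum_congr rfl fun ω _ => Finset.sum_congr rfl fun c _ => ?_
    congr 1
    rw [List.ofFn_succ']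
    simp [Fin.snocEquiv, List.concat_eq_append]

end WordSum

theorem wordSum_le_wordSum {α : Type*} [Fintype α] (g h : List α → ℝ) (r : ℕ) (x : List α)
    (hgh : ∀ y, g y ≤ h y) : wordSum g r x ≤ wordSum h r x := by
  induction r generalizing x with
  | zero => exact hgh x
  | succ r ih => exact Finset.sum_le_sum fun c _ => ih _

theorem wordSum_add {α β : Type*} [Fintype α] [AddCommMonoid β] (g h : List α → β) (r : ℕ)
    (x : List α) :
    wordSum (fun y => g y + h y) r x = wordSum g r x + wordSum h r x := by
  induction r generalizing x with
  | zero => rfl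
  | succ r ih => simp [wordSum, ih, Finset.sum_add_distrib]

theorem wordSum_const_mul {α : Type*} [Fintype α] (a : ℝ) (g : List α → ℝ) (r : ℕ)
    (x : List α) : wordSum (fun y => a * g y) r x = a * wordSum g r x := by
  induction r generalizing x with
  | zero => rfl
  | succ r ih => simp [wordSum, ih, Finset.mul_sum]

theorem wordSum_nonneg {α : Type*} [Fintype α] (g : List α → ℝ) (hg : ∀ y, 0 ≤ g y) (r : ℕ)
    (x : List α) : 0 ≤ wordSum g r x := by
  induction r generalizing x with
  | zero => exact hg x
  | succ r ih => exact Finset.sum_nonneg fun c _ => ih _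

/-! ## Signed mixtures of products and a dominating density

A word lists its symbols with the last coordinate first. -/

section Domination

variable {ι α : Type*} [Fintype ι] [Fintype α] (p : ι → ℕ → α → ℝ)

/-- The probability of a word under the product distribution `s`. -/
def prodMass (s : ι) : List α → ℝ
  | [] => 1
  | c :: x => prodMass s x * p s x.length c

/-- The signed mixture with coefficients `u`. -/
def signedMass (u : ι → ℝ) (x : List α) : ℝ := ∑ s, u s * prodMass p s x

/-- The joint density of a word and of the hidden state after it in the following process: at each
coordinate, with probability `1 / (n + 1)` a uniform symbol is put out and the state is replaced by
a uniform one; otherwise the symbol is drawn from the distribution of the current state. -/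
noncomputable def stateMass (n : ℕ) : List α → ι → ℝ
  | [], _ => 1 / Fintype.card ι
  | c :: x, s => (n * (p s x.length c * stateMass n x s) +
      (∑ b, stateMass n x b) / (Fintype.card α * Fintype.card ι)) / (n + 1)

/-- The density of a word in the process of `stateMass`. -/
noncomputable def mass (n : ℕ) (x : List α) : ℝ := ∑ s, stateMass p n x s

variable {p}

omit [Fintype ι] [Fintype α] in
theorem prodMass_reverse_ofFn {n : ℕ} (s : ι) (ω : Fin n → α) :
    prodMass p s (List.ofFn ω).reverse = ∏ i : Fin n, p s i (ω i) := by
  induction n with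
  | zero => simp [prodMass]
  | succ n ih =>
    rw [List.ofFn_succ', List.concat_eq_append, List.reverse_append, List.reverse_singleton,
      List.singleton_append, prodMass, ih, Fin.prod_univ_castSucc]
    simp

/-- The restart term alone is positive, even where all marginals vanish. Hence every later division
by `mass` is legitimate. -/
theorem stateMass_pos [Nonempty ι] [Nonempty α] (hp : ∀ s i, p s i ∈ stdSimplex ℝ α) (n : ℕ)
    (x : List α) (s : ι) : 0 < stateMass p n x s := by
  induction x generalizing s with
  | nil => simp [stateMass, Fintype.card_pos]
  | cons c x ih =>
    have hV : 0 < ∑ b, stateMass p n x b := Finset.sum_pos (fun b _ => ih b) Finset.univ_nonempty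
    have h1 := (hp s x.length).1 c
    have h2 := (ih s).le
    have h3 : (0 : ℝ) < Fintype.card ι := by exact_mod_cast Fintype.card_pos
    have h4 : (0 : ℝ) < Fintype.card α := by exact_mod_cast Fintype.card_pos
    rw [stateMass]
    positivity

theorem mass_pos [Nonempty ι] [Nonempty α] (hp : ∀ s i, p s i ∈ stdSimplex ℝ α) (n : ℕ)
    (x : List α) : 0 < mass p n x :=
  Finset.sum_pos (fun s _ => stateMass_pos hp n x s) Finset.univ_nonempty

theorem mass_nil [Nonempty ι] (n : ℕ) : mass p n [] = 1 := by
  simp [mass, stateMass]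

theorem mass_cons [Nonempty ι] (n : ℕ) (c : α) (x : List α) :
    mass p n (c :: x) = (n * ∑ s, p s x.length c * stateMass p n x s +
      mass p n x / Fintype.card α) / (n + 1) := by
  have h3 : (Fintype.card ι : ℝ) ≠ 0 := by exact_mod_cast Fintype.card_ne_zero
  simp only [mass, stateMass]
  rw [← Finset.sum_div, Finset.sum_add_distrib, ← Finset.mul_sum, Finset.sum_const,
    Finset.card_univ, nsmul_eq_mul, mul_comm (Fintype.card α : ℝ), ← div_div, ← mul_div_assoc,
    mul_div_cancel₀ _ h3]

/-- Consistency of the prefix densities: `mass p n (c :: x) / mass p n x` is a conditional law, so a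
word can be drawn symbol by symbol. -/
theorem sum_mass_cons [Nonempty ι] [Nonempty α] (hp : ∀ s i, p s i ∈ stdSimplex ℝ α) (n : ℕ)
    (x : List α) : ∑ c, mass p n (c :: x) = mass p n x := by
  have h4 : (Fintype.card α : ℝ) ≠ 0 := by exact_mod_cast Fintype.card_ne_zero
  have h5 : (n + 1 : ℝ) ≠ 0 := by positivity
  simp only [mass_cons]
  rw [← Finset.sum_div, Finset.sum_add_distrib, ← Finset.mul_sum, Finset.sum_comm]
  simp only [← Finset.sum_mul, (hp _ _).2, one_mul, Finset.sum_const, Finset.card_univ,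
    nsmul_eq_mul]
  rw [mul_div_cancel₀ _ h4, ← mass, ← add_one_mul, mul_div_cancel_left₀ _ h5]

theorem wordSum_mass [Nonempty ι] [Nonempty α] (hp : ∀ s i, p s i ∈ stdSimplex ℝ α) (n r : ℕ)
    (x : List α) : wordSum (mass p n) r x = mass p n x := by
  induction r generalizing x with
  | zero => rfl
  | succ r ih => simp only [wordSum, ih, sum_mass_cons hp]

variable (p) in
/-- The `ℓ¹` norm of the marginal of a signed mixture on the first `t` coordinates. -/
def signedNorm (u : ι → ℝ) (t : ℕ) : ℝ := wordSum (fun x => |signedMass p u x|) t []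

theorem signedNorm_nonneg (u : ι → ℝ) (t : ℕ) : 0 ≤ signedNorm p u t :=
  wordSum_nonneg _ (fun _ => abs_nonneg _) _ _

theorem sum_signedMass_cons (hp : ∀ s i, p s i ∈ stdSimplex ℝ α) (u : ι → ℝ) (x : List α) :
    ∑ c, signedMass p u (c :: x) = signedMass p u x := by
  simp only [signedMass, prodMass]
  rw [Finset.sum_comm]
  simp only [← Finset.mul_sum, (hp _ _).2, mul_one]

theorem signedNorm_le_succ (hp : ∀ s i, p s i ∈ stdSimplex ℝ α) (u : ι → ℝ) (t : ℕ) :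
    signedNorm p u t ≤ signedNorm p u (t + 1) := by
  rw [signedNorm, signedNorm, wordSum_succ']
  refine wordSum_le_wordSum _ _ _ _ fun y => ?_
  rw [← sum_signedMass_cons hp]
  exact Finset.abs_sum_le_sum_abs _ _

theorem wordSum_abs_signedMass_cons_le (u : ι → ℝ) (t : ℕ) (c : α) :
    wordSum (fun x => |signedMass p u (c :: x)|) t [] ≤ signedNorm p u (t + 1) := by
  rw [signedNorm, wordSum_succ']
  exact wordSum_le_wordSum _ _ _ _ fun y =>
    Finset.single_le_sum (f := fun c => |signedMass p u (c :: y)|) (fun _ _ => abs_nonneg _)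
      (Finset.mem_univ c)

theorem wordSum_congr_length {β : Type*} [AddCommMonoid β] {g h : List α → β} {r : ℕ}
    {x : List α} (hgh : ∀ y : List α, y.length = x.length + r → g y = h y) :
    wordSum g r x = wordSum h r x := by
  induction r generalizing x with
  | zero => exact hgh x (by simp)
  | succ r ih =>
    exact Finset.sum_congr rfl fun c _ => ih fun y hy => hgh y (by simp at hy; omega)

variable (p) in
/-- The coefficients that remain when, at symbol `c` of coordinate `t`, the product `a` is split off
from the signed mixture with coefficients `u`. -/
def splitCoeff (u : ι → ℝ) (a : ι) (t : ℕ) (c : α) (s : ι) : ℝ := (p s t c - p a t c) * u s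

-- This is the recursion behind the domination: the coefficient of `a` on the left is zero, so the
-- support of the coefficients shrinks.
omit [Fintype α] in
theorem signedMass_splitCoeff (u : ι → ℝ) (a : ι) (c : α) (x : List α) :
    signedMass p (splitCoeff p u a x.length c) x =
      signedMass p u (c :: x) - p a x.length c * signedMass p u x := by
  simp only [signedMass, prodMass, splitCoeff, Finset.mul_sum, ← Finset.sum_sub_distrib]
  exact Finset.sum_congr rfl fun s _ => by ring

/-- Fixing the last symbol and marginalising it out both do not increase the norm; the two
contributions give the factor `2`. -/
theorem signedNorm_splitCoeff_le (hp : ∀ s i, p s i ∈ stdSimplex ℝ α) (u : ι → ℝ) (a : ι) (t : ℕ)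
    (c : α) : signedNorm p (splitCoeff p u a t c) t ≤ 2 * signedNorm p u (t + 1) := by
  have h0 := (hp a t).1 c
  have h1 : p a t c ≤ 1 := by
    rw [← (hp a t).2]
    exact Finset.single_le_sum (fun c _ => (hp a t).1 c) (Finset.mem_univ c)
  calc signedNorm p (splitCoeff p u a t c) t
      = wordSum (fun x => |signedMass p u (c :: x) - p a t c * signedMass p u x|) t [] := by
        refine wordSum_congr_length fun y hy => ?_
        obtain rfl : y.length = t := by simpa using hy
        rw [signedMass_splitCoeff]
    _ ≤ wordSum (fun x => |signedMass p u (c :: x)| + p a t c * |signedMass p u x|) t [] := by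
        refine wordSum_le_wordSum _ _ _ _ fun y => (abs_sub _ _).trans_eq ?_
        rw [abs_mul, abs_of_nonneg h0]
    _ = wordSum (fun x => |signedMass p u (c :: x)|) t [] + p a t c * signedNorm p u t := by
        rw [wordSum_add, wordSum_const_mul, signedNorm]
    _ ≤ signedNorm p u (t + 1) + 1 * signedNorm p u (t + 1) :=
        add_le_add (wordSum_abs_signedMass_cons_le u t c)
          (mul_le_mul h1 (signedNorm_le_succ hp u t) (signedNorm_nonneg _ _) zero_le_one)
    _ = _ := by ring

/-- Induction on the word, with `a` the current state and `S` the components still to be split off,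
one per restart. A restart into `a` can come from any state, so the split part may be bounded with
any `b ∈ S` as its own base. -/
theorem abs_signedMass_le [DecidableEq ι] [Nonempty ι] [Nonempty α]
    (hp : ∀ s i, p s i ∈ stdSimplex ℝ α)
    {n : ℕ} (hn : 1 ≤ n) (x : List α) (u : ι → ℝ) (a : ι) (S : Finset ι)
    (hu : ∀ s, s ∉ insert a S → u s = 0) :
    |signedMass p u x| ≤ signedNorm p u x.length *
      (Fintype.card ι * ((n + 1 : ℝ) / n) ^ x.length *
        (2 * Fintype.card α * Fintype.card ι * (n + 1)) ^ S.card) * stateMass p n x a := by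
  have hk : (0 : ℝ) < Fintype.card ι := by exact_mod_cast Fintype.card_pos
  have hq : (0 : ℝ) < Fintype.card α := by exact_mod_cast Fintype.card_pos
  have hn0 : (0 : ℝ) < n := by exact_mod_cast hn
  induction x generalizing u a S with
  | nil =>
    have h1 : (1 : ℝ) ≤ (2 * Fintype.card α * Fintype.card ι * (n + 1)) ^ S.card := by
      apply one_le_pow₀
      have h2 : (1 : ℝ) ≤ Fintype.card ι := by exact_mod_cast Fintype.card_pos
      have h3 : (1 : ℝ) ≤ Fintype.card α := by exact_mod_cast Fintype.card_pos
      nlinarith [mul_le_mul h3 h2 zero_le_one hq.le]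
    have : |signedMass p u []| = signedNorm p u 0 := rfl
    rw [this]
    simp only [List.length_nil, pow_zero, mul_one, stateMass]
    rw [mul_comm (Fintype.card ι : ℝ), ← mul_assoc, mul_assoc _ (Fintype.card ι : ℝ),
      mul_one_div_cancel hk.ne', mul_one]
    exact le_mul_of_one_le_right (signedNorm_nonneg _ _) h1
  | cons c x ih =>
    set N := signedNorm p u (x.length + 1) with hN
    set B : ℝ := Fintype.card ι * ((n + 1 : ℝ) / n) ^ x.length with hB
    set D : ℝ := 2 * Fintype.card α * Fintype.card ι * (n + 1) with hD
    have hB0 : 0 < B := by positivity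
    have hD0 : 0 < D := by positivity
    have hN0 : 0 ≤ N := signedNorm_nonneg _ _
    have hV := mass_pos hp n x
    have hpa := (hp a x.length).1 c
    have hv := stateMass_pos hp n x a
    have h1 : |signedMass p u x| ≤ N * (B * D ^ S.card) * stateMass p n x a :=
      (ih u a S hu).trans (by gcongr; exact signedNorm_le_succ hp u _)
    have h2 : |signedMass p (splitCoeff p u a x.length c) x| * D ≤
        2 * N * (B * D ^ S.card) * mass p n x := by
      -- With `S` empty only `a` carries a coefficient, and splitting it off leaves nothing.
      -- Otherwise the exponent drops by one, and this pays for the factor `D`.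
      rcases S.eq_empty_or_nonempty with rfl | ⟨b, hb⟩
      · have : signedMass p (splitCoeff p u a x.length c) x = 0 := by
          refine Finset.sum_eq_zero fun s _ => ?_
          by_cases hs : s = a
          · simp [splitCoeff, hs]
          · simp [splitCoeff, hu s (by simp [hs])]
        rw [this, abs_zero, zero_mul]
        positivity
      · have h3 := ih (splitCoeff p u a x.length c) b (S.erase b) fun s hs => by
          rw [Finset.insert_erase hb] at hs
          by_cases hsa : s = a
          · simp [splitCoeff, hsa]
          · simp [splitCoeff, hu s (by simp [hs, hsa])]
        have h4 : stateMass p n x b ≤ mass p n x :=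
          Finset.single_le_sum (fun s _ => (stateMass_pos hp n x s).le) (Finset.mem_univ b)
        have h5 := signedNorm_splitCoeff_le hp u a x.length c
        calc _ ≤ (2 * N * (B * D ^ (S.erase b).card) * mass p n x) * D := by
              refine mul_le_mul_of_nonneg_right (h3.trans ?_) hD0.le
              have := (stateMass_pos hp n x b).le
              gcongr
          _ = 2 * N * (B * D ^ ((S.erase b).card + 1)) * mass p n x := by ring
          _ = _ := by rw [Finset.card_erase_add_one hb]
    have h6 : signedMass p u (c :: x) = p a x.length c * signedMass p u x +
        signedMass p (splitCoeff p u a x.length c) x := by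
      rw [signedMass_splitCoeff]; ring
    have h7 : |signedMass p u (c :: x)| ≤
        p a x.length c * (N * (B * D ^ S.card) * stateMass p n x a) +
          2 * N * (B * D ^ S.card) * mass p n x / D := by
      rw [h6]
      refine (abs_add_le _ _).trans (add_le_add ?_ ?_)
      · rw [abs_mul, abs_of_nonneg hpa]
        gcongr
      · rwa [le_div_iff₀ hD0]
    refine h7.trans ?_
    rw [List.length_cons, ← hN, stateMass, ← mass, pow_succ, ← mul_assoc (Fintype.card ι : ℝ), ← hB]
    have h8 : 2 * N * (B * D ^ S.card) * mass p n x / D = N * (B * D ^ S.card) *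
        (mass p n x / (Fintype.card α * Fintype.card ι)) / (n + 1) := by
      rw [hD]; field_simp
    -- The extra factor `(n+1)/n` cancels the probability `n/(n+1)` of no restart exactly; the
    -- restart term then has denominator `n` against the required `n + 1`.
    have h9 : N * (B * ((n + 1) / n) * D ^ S.card) * ((n * (p a x.length c * stateMass p n x a) +
        mass p n x / (Fintype.card α * Fintype.card ι)) / (n + 1)) =
        p a x.length c * (N * (B * D ^ S.card) * stateMass p n x a) + N * (B * D ^ S.card) *
        (mass p n x / (Fintype.card α * Fintype.card ι)) / n := by
      field_simp
    rw [h8, h9]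
    gcongr
    linarith

theorem one_add_inv_pow_le_three {n : ℕ} (hn : 1 ≤ n) : ((n + 1 : ℝ) / n) ^ n ≤ 3 := by
  have hn0 : (0 : ℝ) < n := by exact_mod_cast hn
  have h1 : (n + 1 : ℝ) / n ≤ Real.exp (1 / n) := by
    rw [add_div, div_self hn0.ne', add_comm]
    exact Real.add_one_le_exp _
  calc ((n + 1 : ℝ) / n) ^ n ≤ Real.exp (1 / n) ^ n := by gcongr
    _ = Real.exp 1 := by rw [← Real.exp_nat_mul, mul_one_div_cancel hn0.ne']
    _ ≤ 3 := by linarith [Real.exp_one_lt_d9]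

/-- How far the density `mass` can fall below the normalized absolute value of a signed mixture. -/
def overhead (k n q : ℕ) : ℕ := 3 * k * (4 * k * (n * q)) ^ (k - 1)

theorem abs_signedMass_le_overhead [Nonempty ι] [Nonempty α] (hp : ∀ s i, p s i ∈ stdSimplex ℝ α)
    {n : ℕ} (hn : 1 ≤ n) (x : List α) (hx : x.length = n) (u : ι → ℝ) :
    |signedMass p u x| ≤ signedNorm p u n *
      (overhead (Fintype.card ι) n (Fintype.card α) : ℝ) * mass p n x := by
  classical
  obtain ⟨a⟩ := ‹Nonempty ι›
  have : Nonempty ι := ⟨a⟩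
  have h := abs_signedMass_le hp hn x u a (Finset.univ.erase a) fun s hs => by simp_all
  have h4 : stateMass p n x a ≤ mass p n x :=
    Finset.single_le_sum (fun s _ => (stateMass_pos hp n x s).le) (Finset.mem_univ a)
  have hn1 : (1 : ℝ) ≤ n := by exact_mod_cast hn
  rw [hx, Finset.card_erase_of_mem (Finset.mem_univ a), Finset.card_univ] at h
  refine h.trans ?_
  have := signedNorm_nonneg (p := p) u n
  have := (stateMass_pos hp n x a).le
  have h5 := one_add_inv_pow_le_three hn
  have h6 : (0 : ℝ) ≤ Fintype.card α * Fintype.card ι := by positivity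
  rw [overhead]
  push_cast
  refine mul_le_mul (mul_le_mul_of_nonneg_left (mul_le_mul ?_ ?_ (by positivity) (by positivity))
    (signedNorm_nonneg _ _)) h4 (by assumption) (by positivity)
  · rw [mul_comm]
    gcongr
  -- This uses `2(n + 1) ≤ 4n`.
  · refine pow_le_pow_left₀ (by positivity) ?_ _
    nlinarith

end Domination

/-! ### Moments of the importance sampling estimate -/

section Estimator

variable {ι α : Type*} [Fintype ι] [Fintype α] {p : ι → ℕ → α → ℝ}

variable (p) in
/-- The importance sampling estimate of half the `ℓ¹` norm of a signed mixture. -/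
noncomputable def estimate (n : ℕ) (u : ι → ℝ) (x : List α) : ℝ :=
  |signedMass p u x| / (2 * mass p n x)

theorem wordSum_mass_mul_estimate [Nonempty ι] [Nonempty α]
    (hp : ∀ s i, p s i ∈ stdSimplex ℝ α) (n t : ℕ) (u : ι → ℝ) :
    wordSum (fun x => mass p n x * estimate p n u x) t [] = signedNorm p u t / 2 := by
  rw [div_eq_inv_mul, signedNorm, ← wordSum_const_mul]
  congr 1
  funext x
  have := (mass_pos hp n x).ne'
  rw [estimate]
  field_simp

theorem estimate_nonneg [Nonempty ι] [Nonempty α] (hp : ∀ s i, p s i ∈ stdSimplex ℝ α) (n : ℕ)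
    (u : ι → ℝ) (x : List α) : 0 ≤ estimate p n u x :=
  div_nonneg (abs_nonneg _) (mul_pos two_pos (mass_pos hp n x)).le

theorem estimate_le [Nonempty ι] [Nonempty α] (hp : ∀ s i, p s i ∈ stdSimplex ℝ α)
    {n : ℕ} (hn : 1 ≤ n) (u : ι → ℝ) (x : List α) (hx : x.length = n) :
    estimate p n u x ≤
      overhead (Fintype.card ι) n (Fintype.card α) * (signedNorm p u n / 2) := by
  rw [estimate, div_le_iff₀ (mul_pos two_pos (mass_pos hp n x))]
  refine (abs_signedMass_le_overhead hp hn x hx u).trans_eq ?_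
  ring

/-- Adding an independent estimate to `a` raises the second moment of the deviation by a bounded
amount. -/
theorem wordSum_mass_mul_sq_le [Nonempty ι] [Nonempty α] (hp : ∀ s i, p s i ∈ stdSimplex ℝ α)
    {n : ℕ} (hn : 1 ≤ n) (u : ι → ℝ) (a : ℝ) :
    wordSum (fun x => mass p n x * (a + estimate p n u x - signedNorm p u n / 2) ^ 2) n [] ≤
      a ^ 2 + overhead (Fintype.card ι) n (Fintype.card α) * (signedNorm p u n / 2) ^ 2 := by
  set d := signedNorm p u n / 2 with hd
  set M : ℝ := (overhead (Fintype.card ι) n (Fintype.card α) : ℝ)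
  have h1 : wordSum (fun x => mass p n x) n [] = 1 := (wordSum_mass hp n n []).trans (mass_nil n)
  have h2 := wordSum_mass_mul_estimate hp n n u
  rw [wordSum_nil_eq_sum] at h1 h2 ⊢
  have h3 : ∀ ω : Fin n → α, mass p n (List.ofFn ω).reverse *
      (a + estimate p n u (List.ofFn ω).reverse - d) ^ 2 ≤
      (a - d) ^ 2 * mass p n (List.ofFn ω).reverse + (2 * (a - d) + M * d) *
        (mass p n (List.ofFn ω).reverse * estimate p n u (List.ofFn ω).reverse) := fun ω => by
    have h4 := estimate_le hp hn u (List.ofFn ω).reverse (by simp)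
    have h5 := estimate_nonneg hp n u (List.ofFn ω).reverse
    have h6 := (mass_pos hp n (List.ofFn ω).reverse).le
    -- For the estimate `X`, boundedness gives `X² ≤ M d X`, so the second moment reduces to the
    -- mean.
    have h7 := mul_le_mul_of_nonneg_left h4 (mul_nonneg h6 h5)
    rw [← hd] at h7
    calc _ = (a - d) ^ 2 * mass p n (List.ofFn ω).reverse + 2 * (a - d) *
          (mass p n (List.ofFn ω).reverse * estimate p n u (List.ofFn ω).reverse) +
          mass p n (List.ofFn ω).reverse * estimate p n u (List.ofFn ω).reverse *
          estimate p n u (List.ofFn ω).reverse := by ring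
      _ ≤ _ := by
        refine (add_le_add_right h7 _).trans_eq ?_
        ring
  refine (Finset.sum_le_sum fun ω _ => h3 ω).trans ?_
  rw [Finset.sum_add_distrib, ← Finset.mul_sum, ← Finset.mul_sum, h1, h2, ← hd]
  -- The left side equals `a² - d² + M d²`.
  nlinarith [sq_nonneg d]

end Estimator

namespace RealRAM

/-! ## Expectations and a program logic -/

/-- The expectation of `ψ`. -/
noncomputable def expect {β : Type*} (μ : PMF β) (ψ : β → ℝ≥0∞) : ℝ≥0∞ := ∑' b, μ b * ψ b

theorem expect_pure {β : Type*} (b : β) (ψ : β → ℝ≥0∞) : expect (PMF.pure b) ψ = ψ b := by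
  rw [expect, tsum_eq_single b]
  · simp
  · intro c hc
    simp [hc]

theorem expect_bind {β γ : Type*} (μ : PMF β) (f : β → PMF γ) (ψ : γ → ℝ≥0∞) :
    expect (μ.bind f) ψ = expect μ fun b => expect (f b) ψ := by
  simp only [expect, PMF.bind_apply, ← ENNReal.tsum_mul_right, ← ENNReal.tsum_mul_left]
  rw [ENNReal.tsum_comm]
  simp only [mul_assoc]

theorem expect_map {β γ : Type*} (μ : PMF β) (f : β → γ) (ψ : γ → ℝ≥0∞) :
    expect (μ.map f) ψ = expect μ fun b => ψ (f b) := by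
  rw [PMF.map, expect_bind]
  simp only [Function.comp, expect_pure]

theorem expect_coin (p : ℝ) (ψ : Bool → ℝ≥0∞) :
    expect (coin p) ψ = ENNReal.ofReal (min p 1) * ψ true +
      (1 - ENNReal.ofReal (min p 1)) * ψ false := by
  rw [expect, tsum_bool, add_comm]
  simp [coin]

theorem steps_one_add (R : ℕ) (c : Config) : steps (1 + R) c = (step c).bind (steps R) := by
  rw [add_comm]
  rfl

/-- The statement `s` takes exactly `T` steps on the memory `m`, and then the expectation of `φ` is
at most `b`. -/
def ExpectLE (s : Stmt) (m : Memory) (T : ℕ) (φ : Memory → ℝ≥0∞) (b : ℝ≥0∞) : Prop :=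
  ∀ (K : List Stmt) (R : ℕ) (ψ : Config → ℝ≥0∞),
    (∀ m', expect (steps R (K, m')) ψ ≤ φ m') → expect (steps (T + R) (s :: K, m)) ψ ≤ b

/-- The statement `s` takes exactly `T` steps on the memory `m` and results in `m'`. -/
def Runs (s : Stmt) (m : Memory) (T : ℕ) (m' : Memory) : Prop :=
  ∀ (K : List Stmt) (R : ℕ), steps (T + R) (s :: K, m) = steps R (K, m')

variable {s t : Stmt} {m m' m'' : Memory} {T T' : ℕ} {φ φ' : Memory → ℝ≥0∞} {b b' : ℝ≥0∞}

theorem Runs.expectLE (h : Runs s m T m') : ExpectLE s m T φ (φ m') := fun K R ψ hψ => by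
  rw [h]
  exact hψ m'

theorem runs_skip : Runs .skip m 1 m := fun K R => by
  rw [steps_one_add, step, PMF.pure_bind]

theorem runs_setNat (a : ℕ) (i x : NExp) :
    Runs (.setNat a i x) m 1 (m.setNat a (i.eval m) (x.eval m)) := fun K R => by
  rw [steps_one_add, step, PMF.pure_bind]

theorem runs_setReal (a : ℕ) (i : NExp) (x : RExp) :
    Runs (.setReal a i x) m 1 (m.setReal a (i.eval m) (x.eval m)) := fun K R => by
  rw [steps_one_add, step, PMF.pure_bind]

theorem Runs.seq (hs : Runs s m T m') (ht : Runs t m' T' m'') :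
    Runs (.seq s t) m (1 + T + T') m'' := fun K R => by
  rw [add_assoc, add_assoc, steps_one_add, step, PMF.pure_bind, hs, ht]

theorem Runs.ite_pos {c : BExp} (hc : c.Holds m) (hs : Runs s m T m') :
    Runs (.ite c s t) m (1 + T) m' := fun K R => by
  rw [add_assoc, steps_one_add, step, PMF.pure_bind, if_pos hc, hs]

theorem Runs.ite_neg {c : BExp} (hc : ¬ c.Holds m) (ht : Runs t m T m') :
    Runs (.ite c s t) m (1 + T) m' := fun K R => by
  rw [add_assoc, steps_one_add, step, PMF.pure_bind, if_neg hc, ht]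

theorem ExpectLE.mono (h : ExpectLE s m T φ b) (hφ : ∀ m', φ' m' ≤ φ m') (hb : b ≤ b') :
    ExpectLE s m T φ' b' := fun K R ψ hψ =>
  (h K R ψ fun m' => (hψ m').trans (hφ m')).trans hb

theorem ExpectLE.seq (ht : ∀ m', ExpectLE t m' T' φ (φ' m')) (hs : ExpectLE s m T φ' b) :
    ExpectLE (.seq s t) m (1 + T + T') φ b := fun K R ψ hψ => by
  rw [add_assoc, add_assoc, steps_one_add, step, PMF.pure_bind]
  exact hs _ _ _ fun m' => ht m' _ _ _ hψ

theorem ExpectLE.seq_of_runs (hs : Runs s m T m') (ht : ExpectLE t m' T' φ b) :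
    ExpectLE (.seq s t) m (1 + T + T') φ b := fun K R ψ hψ => by
  rw [add_assoc, add_assoc, steps_one_add, step, PMF.pure_bind, hs]
  exact ht _ _ _ hψ

theorem ExpectLE.ite_neg {c : BExp} (hc : ¬ c.Holds m) (ht : ExpectLE t m T φ b) :
    ExpectLE (.ite c s t) m (1 + T) φ b := fun K R ψ hψ => by
  rw [add_assoc, steps_one_add, step, PMF.pure_bind, if_neg hc]
  exact ht _ _ _ hψ

theorem expectLE_flip (a : ℕ) (i : NExp) (p : RExp) :
    ExpectLE (.flip a i p) m 1 φ (ENNReal.ofReal (min (p.eval m) 1) * φ (m.setNat a (i.eval m) 1) +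
      (1 - ENNReal.ofReal (min (p.eval m) 1)) * φ (m.setNat a (i.eval m) 0)) := fun K R ψ hψ => by
  rw [steps_one_add, step, expect_bind, expect_map, expect_coin]
  simp only [if_true, Bool.false_eq_true, if_false]
  gcongr <;> exact hψ _

/-! ### Potentials and the loop rule -/

/-- The least value of `v` at a description `x` of the memory; `⊤` if there is no description. -/
noncomputable def potential {X : Type*} (P : X → Memory → Prop) (v : X → ℝ≥0∞) (m : Memory) :
    ℝ≥0∞ := ⨅ (x) (_ : P x m), v x

theorem potential_le {X : Type*} {P : X → Memory → Prop} (v : X → ℝ≥0∞) {x : X} (h : P x m) :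
    potential P v m ≤ v x := iInf₂_le x h

/-- Memories without a description have potential `⊤`, so nothing has to be shown for them. In this
way a potential encodes an invariant together with a bound. -/
theorem ExpectLE.of_potential {X : Type*} {P : X → Memory → Prop} {v : X → ℝ≥0∞}
    (h : ∀ x, P x m → ExpectLE s m T φ (v x)) : ExpectLE s m T φ (potential P v m) :=
  fun K R ψ hψ => le_iInf₂ fun x hx => h x hx K R ψ hψ

theorem Runs.expectLE_potential {X : Type*} {P : X → Memory → Prop} (v : X → ℝ≥0∞) {x : X}
    (h : Runs s m T m') (hx : P x m') : ExpectLE s m T (potential P v) (v x) :=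
  h.expectLE.mono (fun _ => le_rfl) (potential_le v hx)

/-- The values `v j` form a supermartingale along the rounds. The number of rounds and the time of
each are deterministic; every round costs one more step for its test, and the failing test costs the
last one. -/
theorem ExpectLE.loop {X : Type*} {c : BExp} {P : ℕ → X → Memory → Prop} {v : ℕ → X → ℝ≥0∞}
    {N : ℕ} (hc : ∀ j ≤ N, ∀ x m, P j x m → (c.Holds m ↔ j < N))
    (hs : ∀ j < N, ∀ x m, P j x m → ExpectLE s m T (potential (P (j + 1)) (v (j + 1))) (v j x))
    {x : X} (hx : P 0 x m) :
    ExpectLE (.loop c s) m (N * (T + 1) + 1) (potential (P N) (v N)) (v 0 x) := by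
  suffices H : ∀ r j, j + r = N → ∀ x m, P j x m →
      ExpectLE (.loop c s) m (r * (T + 1) + 1) (potential (P N) (v N)) (v j x) from
    H N 0 (zero_add N) x m hx
  intro r
  induction r with
  | zero =>
    intro j hj x m hx K R ψ hψ
    obtain rfl : j = N := by omega
    rw [zero_mul, zero_add, steps_one_add, step, PMF.pure_bind,
      if_neg (by rw [hc _ le_rfl x m hx]; omega)]
    exact (hψ m).trans (potential_le _ hx)
  | succ r ih =>
    intro j hj x m hx K R ψ hψ
    rw [show (r + 1) * (T + 1) + 1 + R = 1 + (T + (r * (T + 1) + 1 + R)) by ring, steps_one_add,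
      step, PMF.pure_bind, if_pos ((hc j (by omega) x m hx).2 (by omega))]
    refine hs j (by omega) x m hx _ _ _ fun m' => ?_
    exact le_iInf₂ fun y hy => ih (j + 1) (by omega) y m' hy K R ψ hψ

/-- A program whose final memory has a finite expected cost halts. -/
theorem haltsWithin_of_expectLE (h : ExpectLE s m T φ b) (hb : b ≠ ⊤) : HaltsWithin s m T := by
  classical
  -- An infinite cost on configurations that have not halted: a single one in the support would make
  -- the expectation infinite.
  have h1 := h [] 0 (fun c => if c.1 = [] then φ c.2 else ⊤) fun m' => by
    simp [steps, expect_pure]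
  intro c hc
  by_contra h2
  have h3 : expect (steps T ([s], m)) (fun c => if c.1 = [] then φ c.2 else ⊤) = ⊤ := by
    refine ENNReal.tsum_eq_top_of_eq_top ⟨c, ?_⟩
    simp only [h2, if_false]
    exact ENNReal.mul_top ((PMF.mem_support_iff _ _).1 hc)
  rw [add_zero, h3] at h1
  exact hb (top_le_iff.1 h1)

theorem expect_outputDist_le {g : ℝ → ℝ≥0∞} (h : ExpectLE s m T (fun m' => g (m'.real 5 0)) b) :
    expect (outputDist s m T) g ≤ b := by
  rw [outputDist, expect_map]
  have h1 := h [] 0 (fun c => g (c.2.real 5 0)) fun m' => by simp [steps, expect_pure]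
  rwa [add_zero] at h1

/-- A form of Chebyshev's inequality. -/
theorem le_toMeasure_Icc_of_expect_le (μ : PMF ℝ) {ε d σ : ℝ} (hε : 0 < ε) (hd : 0 ≤ d)
    (hσ : 100 * σ ≤ ε ^ 2) (h : expect μ (fun a => ENNReal.ofReal ((a - d) ^ 2)) ≤
      ENNReal.ofReal (σ * d ^ 2)) :
    ENNReal.ofReal (99 / 100) ≤ μ.toMeasure (Set.Icc ((1 - ε) * d) ((1 + ε) * d)) := by
  set S := Set.Icc ((1 - ε) * d) ((1 + ε) * d)
  have hS : MeasurableSet S := measurableSet_Icc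
  have hmem : ∀ a, a ∉ S → (ε * d) ^ 2 ≤ (a - d) ^ 2 ∧ 0 < (a - d) ^ 2 := fun a ha => by
    have h1 : ε * d < |a - d| := by
      by_contra h2
      rw [not_lt, abs_le] at h2
      exact ha ⟨by linarith [h2.1], by linarith [h2.2]⟩
    have h3 : 0 ≤ ε * d := by positivity
    rw [← sq_abs (a - d)]
    exact ⟨by gcongr, by have := h3.trans_lt h1; positivity⟩
  have hbad : μ.toMeasure Sᶜ ≤ ENNReal.ofReal (1 / 100) := by
    rw [PMF.toMeasure_apply _ hS.compl]
    -- For `d = 0` Markov's inequality has nothing to divide by, but then the expected squared error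
    -- is zero and no bad value has positive probability.
    rcases hd.eq_or_lt with rfl | hd
    · have h0 : expect μ (fun a => ENNReal.ofReal ((a - 0) ^ 2)) = 0 := by simpa using h
      rw [expect, ENNReal.tsum_eq_zero] at h0
      refine le_of_eq_of_le (ENNReal.tsum_eq_zero.2 fun a => ?_) zero_le
      by_cases ha : a ∈ S
      · simp [ha]
      · rcases mul_eq_zero.1 (h0 a) with h1 | h1
        · simp [h1]
        · exact absurd (ENNReal.ofReal_eq_zero.1 h1) (not_le.2 (hmem a ha).2)
    · have hpos : 0 < (ε * d) ^ 2 := by positivity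
      have h1 : (∑' a, Sᶜ.indicator μ a) * ENNReal.ofReal ((ε * d) ^ 2) ≤
          ENNReal.ofReal (1 / 100) * ENNReal.ofReal ((ε * d) ^ 2) := by
        rw [← ENNReal.tsum_mul_right, ← ENNReal.ofReal_mul (by norm_num)]
        refine (ENNReal.tsum_le_tsum fun a => ?_).trans (h.trans (ENNReal.ofReal_le_ofReal ?_))
        · by_cases ha : a ∈ S
          · simp [ha]
          · rw [Set.indicator_of_mem ha]
            gcongr
            exact ENNReal.ofReal_le_ofReal (hmem a ha).1
        · nlinarith [sq_nonneg d]
      exact (ENNReal.mul_le_mul_iff_left (ENNReal.ofReal_pos.2 hpos).ne'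
        ENNReal.ofReal_ne_top).1 h1
  have h1 : μ.toMeasure S = 1 - μ.toMeasure Sᶜ := by
    rw [← MeasureTheory.prob_compl_eq_one_sub hS.compl, compl_compl]
  rw [h1, show (99 / 100 : ℝ) = 1 - 1 / 100 by norm_num, ENNReal.ofReal_sub _ (by norm_num),
    ENNReal.ofReal_one]
  exact tsub_le_tsub_left hbad 1

end RealRAM

namespace RealRAM

/-! ## Input cells -/

section Input

variable {k k₁ k₂ n q : ℕ}

theorem flatMarginals_apply (P : Mixture k n q) (s : Fin k) (i : Fin n) (c : Fin q) :
    flatMarginals P ((s * n + i) * q + c) = P.marginal s i c := by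
  have h : ((s * n + i) * q + c : ℕ) =
      (finProdFinEquiv (finProdFinEquiv (s, i), c) : Fin (k * n * q)) := by
    simp only [finProdFinEquiv_apply_val]
    ring
  rw [flatMarginals, dif_pos (h ▸ Fin.is_lt _)]
  simp only [h, Fin.eta, Equiv.symm_apply_apply]

theorem flatWeights_apply (P : Mixture k n q) (s : Fin k) : flatWeights P s = P.weight s := by
  simp [flatWeights]

/-- The marginals of the components of `P` and `Q` together, continued periodically beyond the last
coordinate. -/
def jointMarginal [NeZero n] (P : Mixture k₁ n q) (Q : Mixture k₂ n q) (s : Fin (k₁ + k₂)) (i : ℕ) :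
    Fin q → ℝ :=
  Fin.addCases (fun s => P.marginal s (Fin.ofNat n i)) (fun s => Q.marginal s (Fin.ofNat n i)) s

/-- The coefficients of the signed mixture `P - Q`. -/
def jointWeight (P : Mixture k₁ n q) (Q : Mixture k₂ n q) (s : Fin (k₁ + k₂)) : ℝ :=
  Fin.addCases (fun s => P.weight s) (fun s => -Q.weight s) s

theorem jointMarginal_mem [NeZero n] (P : Mixture k₁ n q) (Q : Mixture k₂ n q)
    (s : Fin (k₁ + k₂)) (i : ℕ) : jointMarginal P Q s i ∈ stdSimplex ℝ (Fin q) := by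
  induction s using Fin.addCases with
  | left s => simpa [jointMarginal] using P.marginal_mem s _
  | right s => simpa [jointMarginal] using Q.marginal_mem s _

theorem signedNorm_joint [NeZero n] (P : Mixture k₁ n q) (Q : Mixture k₂ n q) :
    signedNorm (jointMarginal P Q) (jointWeight P Q) n / 2 = P.tvDist Q := by
  rw [signedNorm, wordSum_nil_eq_sum, Mixture.tvDist, one_div, div_eq_inv_mul]
  congr 1
  refine Finset.sum_congr rfl fun ω _ => ?_
  congr 1
  simp only [signedMass, prodMass_reverse_ofFn, Fin.sum_univ_add, jointMarginal, jointWeight,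
    Fin.addCases_left, Fin.addCases_right, Mixture.prob, Fin.ofNat_eq_cast, Fin.cast_val_eq_self,
    neg_mul, Finset.sum_neg_distrib, sub_eq_add_neg]

end Input

/-! ## Derived expressions and statements -/

/-- Entry `0` of a natural number array. -/
abbrev ncell (a : ℕ) : NExp := .read a (.const 0)

/-- Entry `0` of a real array. -/
abbrev rcell (a : ℕ) : RExp := .read a (.const 0)

def NExp.pow (x : NExp) : ℕ → NExp
  | 0 => .const 1
  | j + 1 => .mul (x.pow j) x

theorem NExp.eval_pow (m : Memory) (x : NExp) (j : ℕ) : (x.pow j).eval m = x.eval m ^ j := by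
  induction j with
  | zero => rfl
  | succ j ih => rw [NExp.pow, NExp.eval, ih, pow_succ]

def RExp.sum : (k : ℕ) → (Fin k → RExp) → RExp
  | 0, _ => .cast (.const 0)
  | k + 1, f => .add (RExp.sum k fun s => f s.castSucc) (f (Fin.last k))

theorem RExp.eval_sum (m : Memory) {k : ℕ} (f : Fin k → RExp) :
    (RExp.sum k f).eval m = ∑ s, (f s).eval m := by
  induction k with
  | zero => simp [RExp.sum, RExp.eval, NExp.eval]
  | succ k ih => rw [RExp.sum, RExp.eval, ih, Fin.sum_univ_castSucc]

/-- The statements `f s` one after the other. -/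
def unroll : (k : ℕ) → (Fin k → Stmt) → Stmt
  | 0, _ => .skip
  | k + 1, f => .seq (unroll k fun s => f s.castSucc) (f (Fin.last k))

theorem exists_runs_unroll {k T : ℕ} {f : Fin k → Stmt} (I : ℕ → Memory → Prop)
    (h : ∀ s : Fin k, ∀ m, I s m → ∃ m', Runs (f s) m T m' ∧ I (s + 1) m') {m : Memory}
    (hm : I 0 m) : ∃ m', Runs (unroll k f) m (1 + k * (T + 1)) m' ∧ I k m' := by
  induction k with
  | zero => exact ⟨m, by rw [zero_mul, add_zero]; exact runs_skip, hm⟩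
  | succ k ih =>
    obtain ⟨m₁, h₁, hI₁⟩ := ih (f := fun s => f s.castSucc) fun s m hs => by
      simpa using h s.castSucc m (by simpa using hs)
    obtain ⟨m₂, h₂, hI₂⟩ := h (Fin.last k) m₁ (by simpa using hI₁)
    refine ⟨m₂, ?_, by simpa using hI₂⟩
    rw [show 1 + (k + 1) * (T + 1) = 1 + (1 + k * (T + 1)) + T by ring]
    exact h₁.seq h₂

/-! ## The program

Natural number cells: `2` coordinate, `3` symbol under consideration, `4` chosen symbol, `5` coin,
`6` number of samples.  Real arrays: `6` joint density of the word and the hidden state, `7`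
probability of the word under each component, `8` cumulated density of the symbols considered,
`9` density of the word, `10` sum of the estimates. -/

section Program

variable (k₁ k₂ : ℕ)

/-- The probability of the symbol `c` at the current coordinate under component `s`. -/
def marginalExp (s : Fin (k₁ + k₂)) (c : NExp) : RExp :=
  Fin.addCases
    (fun s => .read 3 (.add (.mul (.add (.mul (.const s) (ncell 0)) (ncell 2)) (ncell 1)) c))
    (fun s => .read 4 (.add (.mul (.add (.mul (.const s) (ncell 0)) (ncell 2)) (ncell 1)) c)) s

def weightExp (s : Fin (k₁ + k₂)) : RExp :=
  Fin.addCases (fun s => .read 1 (.const s))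
    (fun s => .sub (.cast (.const 0)) (.read 2 (.const s))) s

/-- The density of the current word extended by the symbol in cell `3`. -/
def symbolMassExp : RExp :=
  .div (.add (.mul (.cast (ncell 0)) (.sum (k₁ + k₂) fun s =>
      .mul (marginalExp k₁ k₂ s (ncell 3)) (.read 6 (.const s))))
    (.div (rcell 9) (.cast (ncell 1)))) (.cast (.add (ncell 0) (.const 1)))

def chooseStep : Stmt :=
  .seq (.setReal 8 (.const 0) (.add (rcell 8) (symbolMassExp k₁ k₂))) <|
  .seq (.flip 5 (.const 0) (.div (symbolMassExp k₁ k₂) (rcell 8))) <|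
  .seq (.setNat 4 (.const 0) (.add (.mul (ncell 5) (ncell 3))
    (.mul (.sub (.const 1) (ncell 5)) (ncell 4))))
  (.setNat 3 (.const 0) (.add (ncell 3) (.const 1)))

def massExp : RExp := .sum (k₁ + k₂) fun s => .read 6 (.const s)

def chooseInit : Stmt :=
  .seq (.setReal 9 (.const 0) (massExp k₁ k₂)) <|
  .seq (.setReal 8 (.const 0) (.cast (.const 0))) <|
  .seq (.setNat 3 (.const 0) (.const 0)) (.setNat 4 (.const 0) (.const 0))

def extendComponent (s : Fin (k₁ + k₂)) : Stmt :=
  .seq (.setReal 6 (.const s) (.div (.add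
    (.mul (.cast (ncell 0)) (.mul (marginalExp k₁ k₂ s (ncell 4)) (.read 6 (.const s))))
    (.div (rcell 9) (.cast (.mul (ncell 1) (.const (k₁ + k₂))))))
    (.cast (.add (ncell 0) (.const 1)))))
  (.setReal 7 (.const s) (.mul (.read 7 (.const s)) (marginalExp k₁ k₂ s (ncell 4))))

/-- Extend the current word by the chosen symbol. -/
def extend : Stmt :=
  .seq (unroll (k₁ + k₂) (extendComponent k₁ k₂))
    (.setNat 2 (.const 0) (.add (ncell 2) (.const 1)))

def coordinate : Stmt :=
  .seq (chooseInit k₁ k₂) <|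
  .seq (.loop (.not (.natLe (ncell 1) (ncell 3))) (chooseStep k₁ k₂)) (extend k₁ k₂)

def startWord : Stmt :=
  .seq (unroll (k₁ + k₂) fun s =>
    .seq (.setReal 6 (.const s) (.div (.cast (.const 1)) (.cast (.const (k₁ + k₂)))))
      (.setReal 7 (.const s) (.cast (.const 1))))
  (.setNat 2 (.const 0) (.const 0))

def signedMassExp : RExp :=
  .sum (k₁ + k₂) fun s => .mul (weightExp k₁ k₂ s) (.read 7 (.const s))

/-- Add the estimate for the current word to the sum. -/
def record : Stmt :=
  .seq (.setReal 9 (.const 0) (massExp k₁ k₂)) <|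
  .seq (.ite (.realLe (.cast (.const 0)) (signedMassExp k₁ k₂))
    (.setReal 10 (.const 0) (.add (rcell 10)
      (.div (signedMassExp k₁ k₂) (.mul (.cast (.const 2)) (rcell 9)))))
    (.setReal 10 (.const 0) (.sub (rcell 10)
      (.div (signedMassExp k₁ k₂) (.mul (.cast (.const 2)) (rcell 9))))))
  (.setNat 6 (.const 0) (.add (ncell 6) (.const 1)))

def sample : Stmt :=
  .seq (startWord k₁ k₂) <|
  .seq (.loop (.not (.natLe (ncell 0) (ncell 2))) (coordinate k₁ k₂)) (record k₁ k₂)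

def overheadExp : NExp :=
  .mul (.const (3 * (k₁ + k₂)))
    ((NExp.mul (.const (4 * (k₁ + k₂))) (.mul (ncell 0) (ncell 1))).pow (k₁ + k₂ - 1))

/-- The program that estimates the total variation distance. -/
def estimator : Stmt :=
  .ite (.realLe (.cast (.const 1)) (rcell 0)) .skip <|
  .seq (.loop (.realLe (.mul (.cast (ncell 6)) (.mul (rcell 0) (rcell 0)))
    (.cast (.mul (.const 100) (overheadExp k₁ k₂)))) (sample k₁ k₂))
  (.setReal 5 (.const 0) (.div (rcell 10) (.cast (ncell 6))))

end Program

/-! ## Correctness -/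

section Correctness

variable {k₁ k₂ n q : ℕ} {ε : ℝ} {P : Mixture k₁ n q} {Q : Mixture k₂ n q} {r : ℕ} {A : ℝ}
  {m : Memory}

/-- The memory holds the input, the number `r` of samples, and the sum `A` of their estimates. -/
structure Holding (ε : ℝ) (P : Mixture k₁ n q) (Q : Mixture k₂ n q) (r : ℕ) (A : ℝ) (m : Memory) :
    Prop where
  nat_zero : m.nat 0 0 = n
  nat_one : m.nat 1 0 = q
  real_le : ∀ a ≤ 4, m.real a = (input ε P Q).real a
  count : m.nat 6 0 = r
  total : m.real 10 0 = A

theorem Holding.setNat (h : Holding ε P Q r A m) {a : ℕ} (ha : 2 ≤ a) (ha' : a ≠ 6) (i v : ℕ) :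
    Holding ε P Q r A (m.setNat a i v) where
  nat_zero := by simp [Memory.setNat, Function.update_of_ne (show 0 ≠ a by omega), h.nat_zero]
  nat_one := by simp [Memory.setNat, Function.update_of_ne (show 1 ≠ a by omega), h.nat_one]
  real_le := h.real_le
  count := by simp [Memory.setNat, Function.update_of_ne ha'.symm, h.count]
  total := h.total

theorem Holding.setReal (h : Holding ε P Q r A m) {a : ℕ} (ha : 5 ≤ a) (ha' : a ≠ 10) (i : ℕ)
    (v : ℝ) : Holding ε P Q r A (m.setReal a i v) where
  nat_zero := h.nat_zero
  nat_one := h.nat_one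
  real_le b hb := by
    simp [Memory.setReal, Function.update_of_ne (show b ≠ a by omega), h.real_le b hb]
  count := h.count
  total := by simp [Memory.setReal, Function.update_of_ne ha'.symm, h.total]

theorem holding_input : Holding ε P Q 0 0 (input ε P Q) :=
  ⟨rfl, rfl, fun _ _ => rfl, rfl, rfl⟩

theorem Holding.eval_marginalExp [NeZero n] (h : Holding ε P Q r A m) (s : Fin (k₁ + k₂)) (c : NExp)
    {i : ℕ} (hi : i < n) (hm : m.nat 2 0 = i) {d : Fin q} (hd : c.eval m = d) :
    (marginalExp k₁ k₂ s c).eval m = jointMarginal P Q s i d := by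
  have hof : ((Fin.ofNat n i : Fin n) : ℕ) = i := Nat.mod_eq_of_lt hi
  induction s using Fin.addCases with
  | left s =>
    simp only [marginalExp, jointMarginal, Fin.addCases_left, RExp.eval, NExp.eval, h.nat_zero,
      h.nat_one, hm, hd, h.real_le 3 (by norm_num)]
    rw [← flatMarginals_apply, hof]
    rfl
  | right s =>
    simp only [marginalExp, jointMarginal, Fin.addCases_right, RExp.eval, NExp.eval, h.nat_zero,
      h.nat_one, hm, hd, h.real_le 4 (by norm_num)]
    rw [← flatMarginals_apply, hof]
    rfl

theorem Holding.eval_weightExp (h : Holding ε P Q r A m) (s : Fin (k₁ + k₂)) :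
    (weightExp k₁ k₂ s).eval m = jointWeight P Q s := by
  induction s using Fin.addCases with
  | left s =>
    simp only [weightExp, jointWeight, Fin.addCases_left, RExp.eval, NExp.eval,
      h.real_le 1 (by norm_num)]
    exact flatWeights_apply P s
  | right s =>
    simp only [weightExp, jointWeight, Fin.addCases_right, RExp.eval, NExp.eval,
      h.real_le 2 (by norm_num), Nat.cast_zero, zero_sub]
    exact congrArg _ (flatWeights_apply Q s)

/-- The memory holds the data of the word `x`. -/
structure WordAt [NeZero n] (ε : ℝ) (P : Mixture k₁ n q) (Q : Mixture k₂ n q) (r : ℕ) (A : ℝ)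
    (x : List (Fin q)) (m : Memory) : Prop extends Holding ε P Q r A m where
  nat_two : m.nat 2 0 = x.length
  real_six : ∀ s : Fin (k₁ + k₂), m.real 6 s = stateMass (jointMarginal P Q) n x s
  real_seven : ∀ s : Fin (k₁ + k₂), m.real 7 s = prodMass (jointMarginal P Q) s x

variable [NeZero n] {x : List (Fin q)}

theorem WordAt.setNat (h : WordAt ε P Q r A x m) {a : ℕ} (ha : 3 ≤ a) (ha' : a ≠ 6) (i v : ℕ) :
    WordAt ε P Q r A x (m.setNat a i v) where
  toHolding := h.toHolding.setNat (by omega) ha' i v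
  nat_two := by simp [Memory.setNat, Function.update_of_ne (show 2 ≠ a by omega), h.nat_two]
  real_six := h.real_six
  real_seven := h.real_seven

theorem WordAt.setReal (h : WordAt ε P Q r A x m) {a : ℕ} (ha : 8 ≤ a) (ha' : a ≠ 10) (i : ℕ)
    (v : ℝ) : WordAt ε P Q r A x (m.setReal a i v) where
  toHolding := h.toHolding.setReal (by omega) ha' i v
  nat_two := h.nat_two
  real_six s := by
    simp [Memory.setReal, Function.update_of_ne (show 6 ≠ a by omega), h.real_six s]
  real_seven s := by
    simp [Memory.setReal, Function.update_of_ne (show 7 ≠ a by omega), h.real_seven s]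

theorem WordAt.eval_massExp (h : WordAt ε P Q r A x m) :
    (massExp k₁ k₂).eval m = mass (jointMarginal P Q) n x := by
  simp only [massExp, RExp.eval_sum, RExp.eval, NExp.eval, h.real_six, mass]

theorem WordAt.eval_signedMassExp (h : WordAt ε P Q r A x m) :
    (signedMassExp k₁ k₂).eval m = signedMass (jointMarginal P Q) (jointWeight P Q) x := by
  simp only [signedMassExp, RExp.eval_sum, RExp.eval, NExp.eval, h.real_seven,
    h.toHolding.eval_weightExp, signedMass]

theorem WordAt.eval_symbolMassExp [NeZero (k₁ + k₂)] (h : WordAt ε P Q r A x m)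
    (hx : x.length < n) (hV : m.real 9 0 = mass (jointMarginal P Q) n x) {c : Fin q}
    (hc : m.nat 3 0 = c) :
    (symbolMassExp k₁ k₂).eval m = mass (jointMarginal P Q) n (c :: x) := by
  simp only [symbolMassExp, RExp.eval_sum, RExp.eval, NExp.eval, h.real_six, hV, h.nat_zero,
    h.nat_one, fun s => h.toHolding.eval_marginalExp s (ncell 3) hx h.nat_two
      (d := c) (by simpa [NExp.eval] using hc), mass_cons, Fintype.card_fin]
  push_cast
  rfl

/-! ### Choosing a symbol -/

/-- The expected value of `Φ` at the chosen symbol when the symbols below `j` have been considered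
and `c` is the provisional choice. -/
noncomputable def choiceValue (w : ℕ → ℝ) (q : ℕ) (Φ : ℕ → ℝ≥0∞) (j c : ℕ) : ℝ≥0∞ :=
  ENNReal.ofReal ((∑ i ∈ Finset.range j, w i) / ∑ i ∈ Finset.range q, w i) * Φ c +
    ∑ i ∈ Finset.Ico j q, ENNReal.ofReal (w i / ∑ i ∈ Finset.range q, w i) * Φ i

/-- Reservoir sampling: replacing the provisional choice by `j` with probability `w j / (w 0 + ⋯ + w
j)` keeps the choice distributed in proportion to the weights seen so far, so the conditional
expectation is a martingale. -/
theorem choiceValue_step {w : ℕ → ℝ} {q j : ℕ} (hw : ∀ i, 0 ≤ w i) (hj : j < q) (hwj : 0 < w j)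
    (Φ : ℕ → ℝ≥0∞) (c : ℕ) :
    ENNReal.ofReal (min (w j / ∑ i ∈ Finset.range (j + 1), w i) 1) * choiceValue w q Φ (j + 1) j +
      (1 - ENNReal.ofReal (min (w j / ∑ i ∈ Finset.range (j + 1), w i) 1)) *
        choiceValue w q Φ (j + 1) c = choiceValue w q Φ j c := by
  simp only [choiceValue]
  rw [Finset.sum_eq_sum_Ico_succ_bot hj]
  set W := ∑ i ∈ Finset.range q, w i
  set R := ∑ i ∈ Finset.Ico (j + 1) q, ENNReal.ofReal (w i / W) * Φ i
  have hS0 : 0 ≤ ∑ i ∈ Finset.range j, w i := Finset.sum_nonneg fun i _ => hw i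
  rw [Finset.sum_range_succ]
  set S := ∑ i ∈ Finset.range j, w i
  have hS : 0 < S + w j := by linarith
  have hW : 0 ≤ W := Finset.sum_nonneg fun i _ => hw i
  have hp0 : 0 ≤ w j / (S + w j) := by positivity
  have hp1 : w j / (S + w j) ≤ 1 := by rw [div_le_one hS]; linarith
  rw [min_eq_left hp1, ← ENNReal.ofReal_one, ← ENNReal.ofReal_sub _ hp0]
  have h1 : w j / W = w j / (S + w j) * ((S + w j) / W) := by
    rw [div_mul_div_cancel₀ hS.ne']
  have h2 : S / W = (1 - w j / (S + w j)) * ((S + w j) / W) := by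
    rw [one_sub_div hS.ne', add_sub_cancel_right, div_mul_div_cancel₀ hS.ne']
  rw [h1, h2, ENNReal.ofReal_mul hp0, ENNReal.ofReal_mul (sub_nonneg.2 hp1)]
  have h3 : ENNReal.ofReal (w j / (S + w j)) * R + ENNReal.ofReal (1 - w j / (S + w j)) * R = R := by
    rw [← add_mul, ← ENNReal.ofReal_add hp0 (sub_nonneg.2 hp1), add_sub_cancel,
      ENNReal.ofReal_one, one_mul]
  conv_rhs => rw [← h3]
  ring

end Correctness

end RealRAM

namespace RealRAM

section Correctness

variable {k₁ k₂ n q : ℕ} [NeZero n] {ε : ℝ} {P : Mixture k₁ n q} {Q : Mixture k₂ n q} {r : ℕ}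
  {A : ℝ} {m : Memory} {x : List (Fin q)}

/-- The density of `x` extended by the symbol `j`. -/
noncomputable def symbolMass (P : Mixture k₁ n q) (Q : Mixture k₂ n q) (x : List (Fin q)) (j : ℕ) :
    ℝ :=
  if h : j < q then mass (jointMarginal P Q) n (⟨j, h⟩ :: x) else 0

/-- The memory during the choice of a symbol. -/
structure Choosing (ε : ℝ) (P : Mixture k₁ n q) (Q : Mixture k₂ n q) (r : ℕ) (A : ℝ)
    (x : List (Fin q)) (j c : ℕ) (m : Memory) : Prop extends WordAt ε P Q r A x m where
  lt : c < q
  nat_three : m.nat 3 0 = j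
  nat_four : m.nat 4 0 = c
  real_eight : m.real 8 0 = ∑ i ∈ Finset.range j, symbolMass P Q x i
  real_nine : m.real 9 0 = mass (jointMarginal P Q) n x

theorem exists_runs_chooseInit [NeZero q] (h : WordAt ε P Q r A x m) :
    ∃ m', Runs (chooseInit k₁ k₂) m 7 m' ∧ Choosing ε P Q r A x 0 0 m' := by
  refine ⟨_, (runs_setReal _ _ _).seq ((runs_setReal _ _ _).seq
    ((runs_setNat _ _ _).seq (runs_setNat _ _ _))), ?_⟩
  have h1 := h.eval_massExp
  refine
    { toWordAt := ((((h.setReal ?_ ?_ _ _).setReal ?_ ?_ _ _).setNat ?_ ?_ _ _).setNat ?_ ?_ _ _)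
      lt := Nat.pos_of_ne_zero (NeZero.ne q)
      nat_three := ?_
      nat_four := ?_
      real_eight := ?_
      real_nine := ?_ } <;>
  simp [Memory.setNat, Memory.setReal, NExp.eval, RExp.eval, h1]

theorem symbolMass_nonneg [NeZero q] [NeZero (k₁ + k₂)] (x : List (Fin q)) (j : ℕ) :
    0 ≤ symbolMass P Q x j := by
  rw [symbolMass]
  split_ifs
  · exact (mass_pos (jointMarginal_mem P Q) _ _).le
  · exact le_rfl

theorem expectLE_chooseStep [NeZero q] [NeZero (k₁ + k₂)] (Φ : ℕ → ℝ≥0∞) {j c : ℕ} (hj : j < q)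
    (hx : x.length < n) (h : Choosing ε P Q r A x j c m) :
    ExpectLE (chooseStep k₁ k₂) m 7
      (potential (Choosing ε P Q r A x (j + 1)) (choiceValue (symbolMass P Q x) q Φ (j + 1)))
      (choiceValue (symbolMass P Q x) q Φ j c) := by
  set w := symbolMass P Q x with hw
  have hwj : w j = mass (jointMarginal P Q) n (⟨j, hj⟩ :: x) := dif_pos hj
  have he : ∀ m, WordAt ε P Q r A x m → m.real 9 0 = mass (jointMarginal P Q) n x →
      m.nat 3 0 = j → (symbolMassExp k₁ k₂).eval m = w j := fun m h1 h2 h3 => by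
    rw [hwj]
    exact h1.eval_symbolMassExp hx h2 h3
  refine ExpectLE.seq_of_runs (T := 1) (T' := 5) (runs_setReal _ _ _) ?_
  set m₁ := m.setReal 8 (NExp.eval m (.const 0))
    (RExp.eval m (.add (rcell 8) (symbolMassExp k₁ k₂))) with hm₁
  have h8 : m₁.real 8 0 = ∑ i ∈ Finset.range (j + 1), w i := by
    simp [hm₁, Memory.setReal, RExp.eval, NExp.eval, h.real_eight, he m h.toWordAt h.real_nine
      h.nat_three, Finset.sum_range_succ, hw]
  have hw₁ : WordAt ε P Q r A x m₁ := h.toWordAt.setReal (by norm_num) (by norm_num) _ _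
  have h9 : m₁.real 9 0 = mass (jointMarginal P Q) n x := by
    simp [hm₁, Memory.setReal, h.real_nine]
  have h3 : m₁.nat 3 0 = j := h.nat_three
  have h4 : m₁.nat 4 0 = c := h.nat_four
  -- The description is the coin value `b`. The new choice `b * j + (1 - b) * c` selects without a
  -- branch; the truncated subtraction is harmless as `b ≤ 1`.
  refine ExpectLE.seq (T := 1) (T' := 3) (φ' := potential (fun (b : ℕ) m' => m' = m₁.setNat 5 0 b ∧ b ≤ 1)
    fun b => choiceValue w q Φ (j + 1) (b * j + (1 - b) * c)) (fun m' => ?_)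
    ((expectLE_flip _ _ _).mono (fun _ => le_rfl) ?_)
  · refine ExpectLE.of_potential fun b hb => ?_
    obtain ⟨rfl, hb⟩ := hb
    have hlt : b * j + (1 - b) * c < q := by
      have := h.lt
      interval_cases b <;> simpa
    refine Runs.expectLE_potential _ ((runs_setNat _ _ _).seq (runs_setNat _ _ _)) ?_
    refine
      { toWordAt := (((hw₁.setNat ?_ ?_ _ _).setNat ?_ ?_ _ _).setNat ?_ ?_ _ _)
        lt := hlt
        nat_three := ?_
        nat_four := ?_
        real_eight := ?_
        real_nine := ?_ }
    all_goals simp [Memory.setNat, NExp.eval, h3, h4, h8, h9, hw]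
  · rw [← choiceValue_step (fun i => symbolMass_nonneg x i) hj
      (by rw [← hw, hwj]; exact mass_pos (jointMarginal_mem P Q) _ _), ← hw]
    have : (RExp.div (symbolMassExp k₁ k₂) (rcell 8)).eval m₁ =
        w j / ∑ i ∈ Finset.range (j + 1), w i := by
      rw [RExp.eval, he m₁ hw₁ h9 h3, RExp.eval, NExp.eval, h8]
    rw [this]
    gcongr
    · exact (potential_le _ (x := 1) ⟨rfl, le_rfl⟩).trans (by simp)
    · exact (potential_le _ (x := 0) ⟨rfl, zero_le_one⟩).trans (by simp)

/-! ### Appending a symbol and the law of the next symbol -/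

theorem exists_runs_extend {c : Fin q} (hx : x.length < n) (h : Choosing ε P Q r A x q c m) :
    ∃ m', Runs (extend k₁ k₂) m (1 + (1 + (k₁ + k₂) * 4) + 1) m' ∧
      WordAt ε P Q r A (c :: x) m' := by
  obtain ⟨m₁, hm₁, hI⟩ := exists_runs_unroll (k := k₁ + k₂) (T := 3) (m := m)
    (f := extendComponent k₁ k₂)
    -- Components below `j` already belong to `c :: x`, the others still to `x`. Real cell `9` keeps
    -- the total density of `x`, which the restart term needs while array `6` is being overwritten.
    (fun j m => Holding ε P Q r A m ∧ m.nat 2 0 = x.length ∧ m.nat 4 0 = c ∧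
      m.real 9 0 = mass (jointMarginal P Q) n x ∧
      (∀ s : Fin (k₁ + k₂), m.real 6 s = stateMass (jointMarginal P Q) n
        (if (s : ℕ) < j then c :: x else x) s) ∧
      ∀ s : Fin (k₁ + k₂), m.real 7 s = prodMass (jointMarginal P Q) s
        (if (s : ℕ) < j then c :: x else x))
    (fun s m hI => by
      obtain ⟨h0, h2, h4, h9, h6, h7⟩ := hI
      refine ⟨_, (runs_setReal _ _ _).seq (runs_setReal _ _ _), ?_⟩
      have h0' := h0.setReal (a := 6) (by norm_num) (by norm_num) s
        (((n : ℝ) * (jointMarginal P Q s x.length c * stateMass (jointMarginal P Q) n x s) +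
          mass (jointMarginal P Q) n x / ((q : ℝ) * (k₁ + k₂))) / (n + 1))
      have e1 := h0.eval_marginalExp s (ncell 4) hx h2 (d := c) h4
      have e2 := h0'.eval_marginalExp s (ncell 4) hx h2 (d := c) h4
      have h6s := h6 s
      have h7s := h7 s
      rw [if_neg (lt_irrefl _)] at h6s h7s
      have e3 : (RExp.div (.add (.mul (.cast (ncell 0))
          (.mul (marginalExp k₁ k₂ s (ncell 4)) (.read 6 (.const s))))
          (.div (rcell 9) (.cast (.mul (ncell 1) (.const (k₁ + k₂))))))
          (.cast (.add (ncell 0) (.const 1)))).eval m =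
          ((n : ℝ) * (jointMarginal P Q s x.length c * stateMass (jointMarginal P Q) n x s) +
          mass (jointMarginal P Q) n x / ((q : ℝ) * (k₁ + k₂))) / (n + 1) := by
        simp [RExp.eval, NExp.eval, e1, h0.nat_zero, h0.nat_one, h6s, h9]
      rw [e3]
      refine ⟨h0'.setReal (by norm_num) (by norm_num) _ _, h2, h4, h9, fun s' => ?_, fun s' => ?_⟩
      · by_cases hs : s' = s
        · subst hs
          simp [Memory.setReal, NExp.eval, stateMass, mass]
        · have hs' : (s' : ℕ) ≠ s := fun h => hs (Fin.ext h)
          have : (s' : ℕ) < s + 1 ↔ (s' : ℕ) < s := by omega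
          simp [Memory.setReal, NExp.eval, Function.update_of_ne hs', h6, this]
      · by_cases hs : s' = s
        · subst hs
          simp [Memory.setReal, NExp.eval, RExp.eval, prodMass, h7s]
          left
          exact e2
        · have hs' : (s' : ℕ) ≠ s := fun h => hs (Fin.ext h)
          have : (s' : ℕ) < s + 1 ↔ (s' : ℕ) < s := by omega
          simp [Memory.setReal, NExp.eval, Function.update_of_ne hs', h7, this])
    ⟨h.toHolding, h.nat_two, h.nat_four, h.real_nine, by simpa using h.real_six,
      by simpa using h.real_seven⟩
  obtain ⟨h0, h2, h4, h9, h6, h7⟩ := hI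
  refine ⟨_, hm₁.seq (runs_setNat _ _ _), ?_⟩
  refine
    { toHolding := h0.setNat le_rfl (by norm_num) _ _
      nat_two := by simp [Memory.setNat, NExp.eval, h2]
      real_six := fun s => ?_
      real_seven := fun s => ?_ }
  · simpa [Memory.setNat] using h6 s
  · simpa [Memory.setNat] using h7 s

/-- Before any symbol is considered the provisional choice has weight zero, and by `sum_mass_cons`
the weights sum to the density of `x`. -/
theorem choiceValue_zero [NeZero q] [NeZero (k₁ + k₂)] (G : List (Fin q) → ℝ≥0∞)
    (x : List (Fin q)) :
    choiceValue (symbolMass P Q x) q (fun c => if h : c < q then G (⟨c, h⟩ :: x) else 0) 0 0 =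
      ∑ c, ENNReal.ofReal (mass (jointMarginal P Q) n (c :: x) / mass (jointMarginal P Q) n x) *
        G (c :: x) := by
  have h1 : ∑ i ∈ Finset.range q, symbolMass P Q x i = mass (jointMarginal P Q) n x := by
    rw [Finset.sum_range, ← sum_mass_cons (jointMarginal_mem P Q)]
    exact Finset.sum_congr rfl fun c _ => dif_pos c.2
  rw [choiceValue, h1, Finset.range_zero, Finset.sum_empty, zero_div, ENNReal.ofReal_zero, zero_mul,
    zero_add, Nat.Ico_zero_eq_range, Finset.sum_range]
  simp [symbolMass]

def coordinateTime (k q : ℕ) : ℕ := 1 + 7 + (1 + (q * (7 + 1) + 1) + (1 + (1 + k * 4) + 1))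

theorem expectLE_coordinate [NeZero q] [NeZero (k₁ + k₂)] (G : List (Fin q) → ℝ≥0∞)
    (hx : x.length < n) (h : WordAt ε P Q r A x m) :
    ExpectLE (coordinate k₁ k₂) m (coordinateTime (k₁ + k₂) q)
      (potential (fun y m' => y.length = x.length + 1 ∧ WordAt ε P Q r A y m') G)
      (∑ c, ENNReal.ofReal (mass (jointMarginal P Q) n (c :: x) / mass (jointMarginal P Q) n x) *
        G (c :: x)) := by
  obtain ⟨m₁, hm₁, h₁⟩ := exists_runs_chooseInit h
  refine ExpectLE.seq_of_runs hm₁ ?_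
  set Φ : ℕ → ℝ≥0∞ := fun c => if h : c < q then G (⟨c, h⟩ :: x) else 0 with hΦ
  rw [← choiceValue_zero]
  refine ExpectLE.seq (fun m' => ?_) (ExpectLE.loop
    (P := fun j => Choosing ε P Q r A x j)
    (v := choiceValue (symbolMass P Q x) q Φ) (N := q) (fun j hj c m hm => ?_)
    (fun j hj c m hm => expectLE_chooseStep Φ hj hx hm) h₁)
  · refine ExpectLE.of_potential fun c hc => ?_
    obtain ⟨m₂, hm₂, h₂⟩ := exists_runs_extend (c := ⟨c, hc.lt⟩) hx hc
    refine (hm₂.expectLE_potential G ⟨rfl, h₂⟩).mono (fun _ => le_rfl) (le_of_eq ?_)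
    have h1 : ∑ i ∈ Finset.range q, symbolMass P Q x i ≠ 0 := by
      refine (Finset.sum_pos' (fun i _ => symbolMass_nonneg x i) ⟨c, by simpa using hc.lt, ?_⟩).ne'
      rw [symbolMass, dif_pos hc.lt]
      exact mass_pos (jointMarginal_mem P Q) _ _
    simp [choiceValue, div_self h1, hΦ, hc.lt]
  · simp [BExp.Holds, NExp.eval, hm.nat_one, hm.nat_three]

/-! ### Drawing one word and recording its estimate -/

theorem exists_runs_startWord (h : Holding ε P Q r A m) :
    ∃ m', Runs (startWord k₁ k₂) m (1 + (1 + (k₁ + k₂) * 4) + 1) m' ∧ WordAt ε P Q r A [] m' := by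
  obtain ⟨m₁, hm₁, hI⟩ := exists_runs_unroll (k := k₁ + k₂) (T := 3) (m := m)
    (f := fun s : Fin (k₁ + k₂) =>
      .seq (.setReal 6 (.const s) (.div (.cast (.const 1)) (.cast (.const (k₁ + k₂)))))
        (.setReal 7 (.const s) (.cast (.const 1))))
    (fun j m => Holding ε P Q r A m ∧
      ∀ s : Fin (k₁ + k₂), (s : ℕ) < j → m.real 6 s = 1 / ((k₁ + k₂ : ℕ) : ℝ) ∧ m.real 7 s = 1)
    (fun s m hI => by
      refine ⟨_, (runs_setReal _ _ _).seq (runs_setReal _ _ _),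
        (hI.1.setReal (by norm_num) (by norm_num) _ _).setReal (by norm_num) (by norm_num) _ _,
        fun s' hs' => ?_⟩
      by_cases hs : (s' : ℕ) = s
      · simp [Memory.setReal, NExp.eval, RExp.eval, hs]
      · have := hI.2 s' (by omega)
        simp [Memory.setReal, NExp.eval, RExp.eval, Function.update_of_ne hs, this])
    ⟨h, by simp⟩
  refine ⟨_, hm₁.seq (runs_setNat _ _ _), ?_⟩
  refine
    { toHolding := hI.1.setNat le_rfl (by norm_num) _ _
      nat_two := by simp [Memory.setNat, NExp.eval]
      real_six := fun s => ?_
      real_seven := fun s => ?_ }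
  · simpa [Memory.setNat, stateMass] using (hI.2 s s.2).1
  · simpa [Memory.setNat, prodMass] using (hI.2 s s.2).2

theorem exists_runs_record (h : WordAt ε P Q r A x m) :
    ∃ m', Runs (record k₁ k₂) m 6 m' ∧ Holding ε P Q (r + 1)
      (A + estimate (jointMarginal P Q) n (jointWeight P Q) x) m' := by
  have h1 := h.setReal (a := 9) (by norm_num) (by norm_num) 0 ((massExp k₁ k₂).eval m)
  have e1 := h1.eval_signedMassExp
  set m₁ := m.setReal 9 0 ((massExp k₁ k₂).eval m) with hm₁
  have e2 : m₁.real 9 0 = mass (jointMarginal P Q) n x := by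
    simp [hm₁, Memory.setReal, h.eval_massExp]
  -- The absolute value is computed by a branch on the sign; both branches take the same time.
  by_cases hf : 0 ≤ signedMass (jointMarginal P Q) (jointWeight P Q) x
  · refine ⟨_, (runs_setReal _ _ _).seq ((Runs.ite_pos ?_ (runs_setReal _ _ _)).seq
      (runs_setNat _ _ _)), ?_⟩
    · simpa [BExp.Holds, RExp.eval, NExp.eval, ← hm₁, e1] using hf
    · constructor
      · exact h1.nat_zero
      · exact h1.nat_one
      · intro a ha
        rw [← h1.real_le a ha]
        exact Function.update_of_ne (show a ≠ 10 by omega) _ _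
      · simp [Memory.setNat, Memory.setReal, NExp.eval, h.count]
      · simp [Memory.setNat, NExp.eval, ← hm₁]
        simp [Memory.setReal, RExp.eval, NExp.eval, e1, e2, h1.total, estimate, abs_of_nonneg hf]
  · refine ⟨_, (runs_setReal _ _ _).seq ((Runs.ite_neg ?_ (runs_setReal _ _ _)).seq
      (runs_setNat _ _ _)), ?_⟩
    · simpa [BExp.Holds, RExp.eval, NExp.eval, ← hm₁, e1] using hf
    · constructor
      · exact h1.nat_zero
      · exact h1.nat_one
      · intro a ha
        rw [← h1.real_le a ha]
        exact Function.update_of_ne (show a ≠ 10 by omega) _ _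
      · simp [Memory.setNat, Memory.setReal, NExp.eval, h.count]
      · simp [Memory.setNat, NExp.eval, ← hm₁]
        simp [Memory.setReal, RExp.eval, NExp.eval, e1, e2, h1.total, estimate,
          abs_of_neg (not_le.1 hf), neg_div, sub_eq_add_neg]

def sampleTime (k n q : ℕ) : ℕ :=
  1 + (1 + (1 + k * 4) + 1) + (1 + (n * (coordinateTime k q + 1) + 1) + 6)

theorem expectLE_sample [NeZero q] [NeZero (k₁ + k₂)] (H : ℝ → ℝ≥0∞) (h : Holding ε P Q r A m) :
    ExpectLE (sample k₁ k₂) m (sampleTime (k₁ + k₂) n q) (potential (Holding ε P Q (r + 1)) H)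
      (wordSum (fun x => ENNReal.ofReal (mass (jointMarginal P Q) n x) *
        H (A + estimate (jointMarginal P Q) n (jointWeight P Q) x)) n []) := by
  set p := jointMarginal P Q
  have hp : ∀ s i, p s i ∈ stdSimplex ℝ (Fin q) := jointMarginal_mem P Q
  set g : List (Fin q) → ℝ≥0∞ := fun x => ENNReal.ofReal (mass p n x) *
    H (A + estimate p n (jointWeight P Q) x) with hg
  obtain ⟨m₁, hm₁, h₁⟩ := exists_runs_startWord h
  refine ExpectLE.seq_of_runs hm₁ ?_
  have hv0 : wordSum g n [] = ENNReal.ofReal (1 / mass p n []) * wordSum g (n - 0) [] := by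
    rw [mass_nil]; simp
  rw [hv0]
  refine ExpectLE.seq (fun m' => ?_) (ExpectLE.loop (x := [])
    (P := fun j x m => x.length = j ∧ WordAt ε P Q r A x m)
    -- The conditional expectation of the final value given the prefix `x` of length `j`.
    (v := fun j x => ENNReal.ofReal (1 / mass p n x) * wordSum g (n - j) x) (N := n)
    (T := coordinateTime (k₁ + k₂) q)
    (fun j hj x m hm => ?_) (fun j hj x m hm => ?_) ⟨rfl, h₁⟩)
  · refine ExpectLE.of_potential fun x hx => ?_
    obtain ⟨m₂, hm₂, h₂⟩ := exists_runs_record hx.2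
    refine (hm₂.expectLE_potential H h₂).mono (fun _ => le_rfl) (le_of_eq ?_)
    have := mass_pos hp n x
    rw [Nat.sub_self, wordSum, hg, ← mul_assoc, ← ENNReal.ofReal_mul (by positivity),
      one_div_mul_cancel this.ne', ENNReal.ofReal_one, one_mul]
  · simp [BExp.Holds, NExp.eval, hm.2.nat_zero, hm.2.nat_two, hm.1]
  · obtain ⟨rfl, hm⟩ := hm
    refine (expectLE_coordinate _ hj hm).mono (fun _ => le_rfl) (le_of_eq ?_)
    rw [show n - x.length = n - (x.length + 1) + 1 by omega, wordSum, Finset.mul_sum]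
    refine Finset.sum_congr rfl fun c _ => ?_
    have h1 := mass_pos hp n x
    have h2 := mass_pos hp n (c :: x)
    rw [← mul_assoc, ← ENNReal.ofReal_mul (by positivity), div_mul_div_comm, mul_one,
      mul_comm (mass p n x), ← div_div, div_self h2.ne']

end Correctness

end RealRAM

theorem Mixture.tvDist_nonneg {k₁ k₂ n q : ℕ} (P : Mixture k₁ n q) (Q : Mixture k₂ n q) :
    0 ≤ P.tvDist Q :=
  mul_nonneg (by norm_num) (Finset.sum_nonneg fun _ _ => abs_nonneg _)

namespace RealRAM

/-! ### Averaging the samples, and the running time -/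

section Main

variable {k₁ k₂ n q : ℕ} {ε : ℝ} {P : Mixture k₁ n q} {Q : Mixture k₂ n q} {r : ℕ} {A : ℝ}
  {m : Memory}

theorem Holding.eval_overheadExp (h : Holding ε P Q r A m) :
    (overheadExp k₁ k₂).eval m = overhead (k₁ + k₂) n q := by
  simp [overheadExp, NExp.eval, NExp.eval_pow, h.nat_zero, h.nat_one, overhead]

/-- The number of samples. -/
noncomputable def sampleCount (k n q : ℕ) (ε : ℝ) : ℕ := ⌊100 * overhead k n q / ε ^ 2⌋₊ + 1

noncomputable def estimatorTime (k n q : ℕ) (ε : ℝ) : ℕ :=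
  1 + (1 + (sampleCount k n q ε * (sampleTime k n q + 1) + 1) + 1)

theorem expectLE_estimator [NeZero n] [NeZero q] [NeZero (k₁ + k₂)] (hε : 0 < ε) (hε1 : ε < 1) :
    ExpectLE (estimator k₁ k₂) (input ε P Q) (estimatorTime (k₁ + k₂) n q ε)
      (fun m => ENNReal.ofReal ((m.real 5 0 - P.tvDist Q) ^ 2))
      (ENNReal.ofReal (overhead (k₁ + k₂) n q / sampleCount (k₁ + k₂) n q ε * P.tvDist Q ^ 2)) := by
  set d := P.tvDist Q with hd
  set N := sampleCount (k₁ + k₂) n q ε with hN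
  set M : ℝ := (overhead (k₁ + k₂) n q : ℝ) with hM
  have hN0 : (0 : ℝ) < N := by rw [hN, sampleCount]; positivity
  have hM0 : 0 ≤ M := by positivity
  have hb : ENNReal.ofReal (M / N * d ^ 2) =
      ENNReal.ofReal ((((0 : ℝ) - ((0 : ℕ) : ℝ) * d) ^ 2 + (N - (0 : ℕ)) * (M * d ^ 2)) / N ^ 2) := by
    congr 1
    field_simp
    simp
    ring
  rw [hb]
  refine ExpectLE.ite_neg ?_ (ExpectLE.seq (fun m' => ?_) (ExpectLE.loop (x := (0 : ℝ))
    (P := fun r A m => Holding ε P Q r A m)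
    -- A bound for the expected squared error of the final average, given the sum `A` of the first
    -- `r` estimates: each remaining sample adds at most `M d²` to the second moment of the
    -- deviation of the sum.
    (v := fun r A => ENNReal.ofReal (((A - (r : ℝ) * d) ^ 2 + (N - r) * (M * d ^ 2)) / N ^ 2))
    (N := N) (T := sampleTime (k₁ + k₂) n q)
    (fun r hr A m hm => ?_) (fun r hr A m hm => ?_) holding_input))
  · simpa [BExp.Holds, RExp.eval, NExp.eval, input] using hε1
  · refine ExpectLE.of_potential fun A hA => ?_
    refine (runs_setReal _ _ _).expectLE.mono (fun _ => le_rfl) (le_of_eq ?_)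
    congr 1
    simp [Memory.setReal, NExp.eval, RExp.eval, hA.total, hA.count]
    field_simp
  -- The machine cannot round, so the guard tests `r ε² ≤ 100 M`. This is `r ≤ ⌊100 M / ε²⌋`, that
  -- is, `r < N`.
  · have h1 : m.real 0 0 = ε := by rw [hm.real_le 0 (by norm_num)]; rfl
    simp only [BExp.Holds, RExp.eval, NExp.eval, hm.count, h1, hm.eval_overheadExp]
    rw [hN, sampleCount, Nat.lt_succ_iff, Nat.le_floor_iff (by positivity),
      le_div_iff₀ (by positivity), sq]
    push_cast
    rfl
  · refine (expectLE_sample _ hm).mono (fun _ => le_rfl) ?_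
    have hp := jointMarginal_mem P Q
    have h1 := wordSum_mass_mul_sq_le hp (NeZero.one_le (n := n)) (jointWeight P Q) (A - r * d)
    rw [signedNorm_joint, ← hd, Fintype.card_fin, Fintype.card_fin, ← hM] at h1
    have h2 := wordSum_mass hp n n []
    rw [mass_nil] at h2
    rw [wordSum_nil_eq_sum] at h1 h2 ⊢
    have hr' : (r : ℝ) + 1 ≤ N := by exact_mod_cast hr
    have hc : 0 ≤ (N - ((r : ℝ) + 1)) * (M * d ^ 2) :=
      mul_nonneg (by linarith) (by positivity)
    have h3 : ∀ ω : Fin n → Fin q, 0 ≤ mass (jointMarginal P Q) n (List.ofFn ω).reverse :=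
      fun ω => (mass_pos hp n _).le
    simp only [← ENNReal.ofReal_mul (h3 _)]
    rw [← ENNReal.ofReal_sum_of_nonneg fun ω _ => mul_nonneg (h3 ω) (by push_cast; positivity)]
    refine ENNReal.ofReal_le_ofReal ?_
    simp only [← mul_div_assoc]
    rw [← Finset.sum_div]
    gcongr
    push_cast
    simp only [mul_add (mass _ _ _)]
    rw [Finset.sum_add_distrib, ← Finset.sum_mul, h2, one_mul]
    have h4 : ∑ ω : Fin n → Fin q, mass (jointMarginal P Q) n (List.ofFn ω).reverse *
        (A + estimate (jointMarginal P Q) n (jointWeight P Q) (List.ofFn ω).reverse -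
          (r + 1) * d) ^ 2 ≤ (A - r * d) ^ 2 + M * d ^ 2 := by
      refine le_of_eq_of_le (Finset.sum_congr rfl fun ω _ => ?_) h1
      ring
    linarith

theorem sampleTime_le {k n q : ℕ} (hn : 1 ≤ n) (hq : 1 ≤ q) :
    sampleTime k n q + 1 ≤ (50 + 8 * k) * (n * q) := by
  obtain ⟨n, rfl⟩ := Nat.exists_eq_add_of_le' hn
  obtain ⟨q, rfl⟩ := Nat.exists_eq_add_of_le' hq
  rw [sampleTime, coordinateTime]
  ring_nf
  nlinarith [Nat.zero_le (n * q), Nat.zero_le (k * q), Nat.zero_le (k * n * q)]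

theorem estimatorTime_le {k n q : ℕ} (hk : 2 ≤ k) (hn : 1 ≤ n) (hq : 1 ≤ q) (hε : 0 < ε)
    (hε1 : ε < 1) : (estimatorTime k n q ε : ℝ) ≤
      ((4 + 101 * (3 * k * (4 * k) ^ (k - 1)) * (50 + 8 * k) : ℕ) : ℝ) *
        ((q : ℝ) ^ 2 * ((n : ℝ) * q) ^ (2 * (k - 1)) / ε ^ 2) := by
  set D : ℕ := 3 * k * (4 * k) ^ (k - 1) with hD
  have hn' : (1 : ℝ) ≤ n := by exact_mod_cast hn
  have hq' : (1 : ℝ) ≤ q := by exact_mod_cast hq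
  have hnq : (1 : ℝ) ≤ (n : ℝ) * q := by nlinarith
  have hε2 : ε ^ 2 ≤ 1 := by nlinarith
  have hε0 : 0 < ε ^ 2 := by positivity
  have hM : (overhead k n q : ℝ) = D * ((n : ℝ) * q) ^ (k - 1) := by
    rw [overhead, mul_pow, hD]
    push_cast
    ring
  have hM1 : (1 : ℝ) ≤ overhead k n q := by
    have : 1 ≤ overhead k n q := Nat.one_le_iff_ne_zero.2 (by
      rw [overhead]
      have : k ≠ 0 := by omega
      have : n ≠ 0 := by omega
      have : q ≠ 0 := by omega
      positivity)
    exact_mod_cast this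
  have hN : (sampleCount k n q ε : ℝ) ≤ 101 * overhead k n q / ε ^ 2 := by
    rw [sampleCount]
    push_cast
    have h1 := Nat.floor_le (a := 100 * (overhead k n q : ℝ) / ε ^ 2) (by positivity)
    have h2 : 1 ≤ (overhead k n q : ℝ) / ε ^ 2 := by rw [one_le_div hε0]; linarith
    have h3 : 101 * (overhead k n q : ℝ) / ε ^ 2 =
      100 * overhead k n q / ε ^ 2 + overhead k n q / ε ^ 2 := by ring
    linarith
  have hT : (sampleTime k n q + 1 : ℝ) ≤ (50 + 8 * k : ℕ) * ((n : ℝ) * q) := by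
    exact_mod_cast sampleTime_le hn hq
  set B : ℝ := (q : ℝ) ^ 2 * ((n : ℝ) * q) ^ (2 * (k - 1)) with hB
  -- The samples contribute `(nq)^(k-1)` and the time of each contributes `nq`; `k ≥ 2` gives `k ≤
  -- 2(k-1)`.
  have hB1 : ((n : ℝ) * q) ^ k ≤ B := by
    have h1 : ((n : ℝ) * q) ^ k ≤ ((n : ℝ) * q) ^ (2 * (k - 1)) :=
      pow_le_pow_right₀ hnq (by omega)
    have h2 : (1 : ℝ) ≤ (q : ℝ) ^ 2 := one_le_pow₀ hq'
    exact h1.trans (le_mul_of_one_le_left (by positivity) h2)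
  -- Absorbs the `4` steps spent outside the rounds of the sampling loop.
  have hB2 : 1 ≤ B / ε ^ 2 := by
    rw [one_le_div hε0]
    exact hε2.trans ((one_le_pow₀ hnq).trans hB1)
  have hmain : (sampleCount k n q ε : ℝ) * (sampleTime k n q + 1) ≤
      101 * D * (50 + 8 * k : ℕ) * (B / ε ^ 2) := by
    calc (sampleCount k n q ε : ℝ) * (sampleTime k n q + 1)
        ≤ (101 * overhead k n q / ε ^ 2) * ((50 + 8 * k : ℕ) * ((n : ℝ) * q)) := by gcongr
      _ = 101 * D * (50 + 8 * k : ℕ) * (((n : ℝ) * q) ^ k / ε ^ 2) := by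
        rw [hM]
        have : ((n : ℝ) * q) ^ k = ((n : ℝ) * q) ^ (k - 1) * (n * q) := by
          rw [← pow_succ]; congr 1; omega
        rw [this]
        ring
      _ ≤ _ := by gcongr
  rw [estimatorTime]
  push_cast at hmain ⊢
  linarith

end Main

end RealRAM

theorem theorem1 (k₁ k₂ : ℕ) (hk₁ : 1 ≤ k₁) (hk₂ : 1 ≤ k₂) :
    ∃ (prog : RealRAM.Stmt) (C : ℝ),
      ∀ (n q : ℕ), 1 ≤ n → 1 ≤ q →
      ∀ (P : Mixture k₁ n q) (Q : Mixture k₂ n q) (ε : ℝ), 0 < ε →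
        ∃ T : ℕ,
          (T : ℝ) ≤ C * max 1 ((q : ℝ) ^ 2 * ((n : ℝ) * q) ^ (2 * (k₁ + k₂ - 1)) / ε ^ 2) ∧
          RealRAM.HaltsWithin prog (RealRAM.input ε P Q) T ∧
          ENNReal.ofReal (99 / 100) ≤
            (RealRAM.outputDist prog (RealRAM.input ε P Q) T).toMeasure
              (Set.Icc ((1 - ε) * P.tvDist Q) ((1 + ε) * P.tvDist Q)) := by
  set D : ℕ := 4 + 101 * (3 * (k₁ + k₂) * (4 * (k₁ + k₂)) ^ (k₁ + k₂ - 1)) * (50 + 8 * (k₁ + k₂))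
    with hD
  refine ⟨RealRAM.estimator k₁ k₂, D, fun n q hn hq P Q ε hε => ?_⟩
  have : NeZero n := ⟨by omega⟩
  have : NeZero q := ⟨by omega⟩
  have : NeZero (k₁ + k₂) := ⟨by omega⟩
  have hd := P.tvDist_nonneg Q
  -- For `ε ≥ 1` the program halts at once; its output cell is still `0`, which lies in the interval
  -- because `(1 - ε) d ≤ 0`.
  rcases le_or_gt 1 ε with h1 | h1
  · have hrun : RealRAM.Runs (RealRAM.estimator k₁ k₂) (RealRAM.input ε P Q) 2
        (RealRAM.input ε P Q) :=
      RealRAM.Runs.ite_pos (by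
        simpa [RealRAM.BExp.Holds, RealRAM.RExp.eval, RealRAM.NExp.eval, RealRAM.input] using h1)
        RealRAM.runs_skip
    refine ⟨2, ?_, RealRAM.haltsWithin_of_expectLE (hrun.expectLE (φ := 0)) ENNReal.zero_ne_top, ?_⟩
    · have h2 : (2 : ℝ) ≤ D := by
        have : 2 ≤ D := by rw [hD]; omega
        exact_mod_cast this
      exact h2.trans (le_mul_of_one_le_right (by linarith) (le_max_left _ _))
    · have h2 : RealRAM.outputDist (RealRAM.estimator k₁ k₂) (RealRAM.input ε P Q) 2 =
          PMF.pure 0 := by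
        have := hrun [] 0
        rw [add_zero] at this
        rw [RealRAM.outputDist, this, RealRAM.steps, PMF.pure_map]
        rfl
      rw [h2, PMF.toMeasure_pure, MeasureTheory.Measure.dirac_apply' _ measurableSet_Icc,
        Set.indicator_of_mem (Set.mem_Icc.2
          ⟨mul_nonpos_of_nonpos_of_nonneg (by linarith) hd, mul_nonneg (by linarith) hd⟩)]
      exact ENNReal.ofReal_le_one.2 (by norm_num)
  · have h2 := RealRAM.expectLE_estimator (P := P) (Q := Q) hε h1
    refine ⟨_, ?_, RealRAM.haltsWithin_of_expectLE h2 ENNReal.ofReal_ne_top,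
      RealRAM.le_toMeasure_Icc_of_expect_le _ hε hd ?_ (RealRAM.expect_outputDist_le
        (g := fun a => ENNReal.ofReal ((a - P.tvDist Q) ^ 2)) h2)⟩
    · refine (RealRAM.estimatorTime_le (by omega) hn hq hε h1).trans ?_
      exact mul_le_mul_of_nonneg_left (le_max_right _ _) (Nat.cast_nonneg _)
    -- The number of samples exceeds `100 M / ε²`, so the relative variance bound `M / N` is at most
    -- `ε² / 100`.
    · have h3 := (Nat.lt_floor_add_one
        (100 * (overhead (k₁ + k₂) n q : ℝ) / ε ^ 2)).le
      rw [← mul_div_assoc, div_le_iff₀ (by rw [RealRAM.sampleCount]; positivity)]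
      rw [div_le_iff₀ (by positivity)] at h3
      rw [RealRAM.sampleCount]
      push_cast
      linarith
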